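/- All manifolds are finite-dimensional and smooth. Let $\pi_{PX}:P\to X$ be a principal bundle with structure Lie group $G$ (acting on $P$ on the right), let $H\subset G$ be a closed Lie subgroup, and let $\Sigma=P/H$ with its smooth structure for which $\pi_{P\Sigma}:P\to\Sigma$ is a principal $H$-bundle; let $\pi_{\Sigma X}:\Sigma\to X$ be the induced projection. Let $V$ be a manifold with a smooth left action of $H$, and let $Y=(P\times V)/H$, $(p,v)\sim(pg,g^{-1}v)$, be the associated bundle over $\Sigma$. A connection on a fibre bundle $\pi:Z\to B$ is a smooth family of splittings $T_{\pi(z)}B\to T_zZ$ of $T\pi$ (horizontal lifts). It is principal if it is invariant under the structure group. The connection on $(Z\times V)/K$ associated to a principal connection on a principal $K$-bundle $Z$ is the one whose horizontal lift of $u$ at $[z,v]$ is the image of the horizontal lift of $u$ at $z$ under the tangent map of $z'\mapsto[z',v]$. The pull-back of a connection along $f:B'\to B$ is the connection on $f^*Z\to B'$ such that the tangent map of $f^*Z\to Z$ sends the horizontal lift of $u$ to the horizontal lift of $Tf(u)$. Let $A_\Sigma$ be a principal connection on $P\to\Sigma$. Then there is a unique connection $A_{Y\Sigma}$ on $Y\to\Sigma$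 associated to $A_\Sigma$. Let $h:X\to\Sigma$ be any smooth global section of $\pi_{\Sigma X}$, and put $P^h=h^*P\to X$ and $Y^h=h^*Y\to X$. Then $P^h$ is a principal $H$-bundle and $Y^h=(P^h\times V)/H$ is associated to it; the pull-back connections $h^*A_\Sigma$ on $P^h$ and $A_h=h^*A_{Y\Sigma}$ on $Y^h$ exist and are unique; $h^*A_\Sigma$ is principal; and $A_h$ is associated to $h^*A_\Sigma$. Moreover, let $(x^\lambda)$ be local coordinates on $X$, $(x^\lambda,\sigma^m)$ fibred local coordinates on $\Sigma\to X$, $(y^i)$ local coordinates on $V$, $z$ a local section of $P\to\Sigma$, and $\{e_a\}$ a basis of the Lie algebra of $H$. With respect to the trivializations defined by $z$, write $$A_\Sigma=dx^\lambda\otimes(\partial_\lambda+\mathcal A^a_\lambda e_a)+d\sigma^m\otimes(\partial_m+\mathcal A^a_m e_a),$$ where along $z$ the vectors $\partial_\lambda,\partial_m$ on $P$ are the images under $Tz$ of the coordinate vectors on $\Sigma$, and $e_a$ stands for the vertical vector $\frac{d}{dt}\big|_{0}\,z\exp(te_a)$; such functions $\mathcal A^a_\lambda,\mathcal A^a_m$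 of $(x^\mu,\sigma^k)$ exist. Let $I_a=I_a^i\partial_i$ be the vector field $v\mapsto\frac{d}{dt}\big|_{0}\exp(te_a)v$ on $V$. Then, in the coordinates $(x^\lambda,\sigma^m,y^i)$ on $Y$ and $(x^\lambda,y^i)$ on $Y^h$ given by $[z(\sigma),v]$ and $[z(h(x)),v]$, $$A_{Y\Sigma}=dx^\lambda\otimes(\partial_\lambda+\mathcal A^a_\lambda I_a^i\partial_i)+d\sigma^m\otimes(\partial_m+\mathcal A^a_m I_a^i\partial_i),$$ $$A_h=h^*A_{Y\Sigma}=dx^\lambda\otimes\bigl[\partial_\lambda+\bigl(\mathcal A^a_m(x^\mu,h^k(x))\,\partial_\lambda h^m+\mathcal A^a_\lambda(x^\mu,h^k(x))\bigr)I_a^i\partial_i\bigr].$$ -/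

import Mathlib

open Set Topology
open scoped Manifold ContDiff

noncomputable section

namespace Gauge

/-! ### Smooth fibre bundles -/

section Bundles

variable {EB HB : Type*} [NormedAddCommGroup EB] [NormedSpace ℝ EB] [TopologicalSpace HB]
  {EF HF : Type*} [NormedAddCommGroup EF] [NormedSpace ℝ EF] [TopologicalSpace HF]
  {EZ HZ : Type*} [NormedAddCommGroup EZ] [NormedSpace ℝ EZ] [TopologicalSpace HZ]
  (IZ : ModelWithCorners ℝ EZ HZ) (IB : ModelWithCorners ℝ EB HB) (IF : ModelWithCorners ℝ EF HF)
  {B F Z : Type*} [TopologicalSpace B] [ChartedSpace HB B] [TopologicalSpace F] [ChartedSpace HF F]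
  [TopologicalSpace Z] {π : Z → B}

/-- A local trivialization `π ⁻¹ U ≃ U × F` which is a diffeomorphism. -/
structure IsSmoothTrivialization [ChartedSpace HZ Z] (e : Bundle.Trivialization F π) : Prop where
  contMDiffOn_toFun : ContMDiffOn IZ (IB.prod IF) ∞ e e.source
  contMDiffOn_invFun : ContMDiffOn (IB.prod IF) IZ ∞ e.toOpenPartialHomeomorph.symm e.target

variable (F π) in
/-- `π : Z → B` is a smooth fibre bundle with typical fibre `F`. -/
def IsSmoothFiberBundle [ChartedSpace HZ Z] : Prop :=
  ∀ b : B, ∃ e : Bundle.Trivialization F π, b ∈ e.baseSet ∧ IsSmoothTrivialization IZ IB IF e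

variable (F π) in
/-- A family of local trivializations of a map `π : Z → B` from a topological space to a manifold,
with smooth transition functions. -/
structure BundleAtlas where
  /-- a local trivialization around each point -/
  triv : B → Bundle.Trivialization F π
  mem_baseSet : ∀ b, b ∈ (triv b).baseSet
  smooth_transition : ∀ b b', ContMDiffOn (IB.prod IF) (IB.prod IF) ∞
    ((triv b).toOpenPartialHomeomorph.symm ≫ₕ (triv b').toOpenPartialHomeomorph)
    ((triv b).toOpenPartialHomeomorph.symm ≫ₕ (triv b').toOpenPartialHomeomorph).source

namespace BundleAtlas

variable {IB IF} (A : BundleAtlas IB IF F π)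

/-- The total space modelled on `B × F` through the trivializations. -/
@[reducible] def chartedSpaceProd : ChartedSpace (B × F) Z where
  atlas := range fun b => (A.triv b).toOpenPartialHomeomorph
  chartAt z := (A.triv (π z)).toOpenPartialHomeomorph
  mem_chart_source z := (A.triv (π z)).mem_source.2 (A.mem_baseSet _)
  chart_mem_atlas z := ⟨π z, rfl⟩

/-- The manifold structure of the total space of a bundle given by an atlas of local
trivializations: charts are the trivializations followed by product charts of `B × F`. -/
@[reducible] def chartedSpace : ChartedSpace (ModelProd HB HF) Z :=
  letI := A.chartedSpaceProd
  ChartedSpace.comp (ModelProd HB HF) (B × F) Z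

theorem isManifold [IsManifold IB ∞ B] [IsManifold IF ∞ F] :
    letI := A.chartedSpace
    IsManifold (IB.prod IF) ∞ Z := by
  let := A.chartedSpaceProd
  let := A.chartedSpace
  have key : ∀ (b b' : B) (f f' : OpenPartialHomeomorph (B × F) (ModelProd HB HF)),
      f ∈ atlas (ModelProd HB HF) (B × F) → f' ∈ atlas (ModelProd HB HF) (B × F) →
      ContMDiffOn (IB.prod IF) (IB.prod IF) ∞
        (((A.triv b).toOpenPartialHomeomorph ≫ₕ f).symm ≫ₕ
          ((A.triv b').toOpenPartialHomeomorph ≫ₕ f'))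
        (((A.triv b).toOpenPartialHomeomorph ≫ₕ f).symm ≫ₕ
          ((A.triv b').toOpenPartialHomeomorph ≫ₕ f')).source := by
    intro b b' f f' hf hf'
    have h1 := contMDiffOn_symm_of_mem_maximalAtlas (I := IB.prod IF) (n := ∞)
      (IsManifold.subset_maximalAtlas hf)
    have h2 := contMDiffOn_of_mem_maximalAtlas (I := IB.prod IF) (n := ∞)
      (IsManifold.subset_maximalAtlas hf')
    have h3 := A.smooth_transition b b'
    refine (h2.comp (h3.comp (h1.mono ?_) ?_) ?_)
    · intro x hx
      simp only [mfld_simps] at hx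
      exact hx.1.1
    · intro x hx
      simp only [mfld_simps] at hx ⊢
      tauto
    · intro x hx
      simp only [mfld_simps] at hx ⊢
      tauto
  refine @IsManifold.mk _ _ _ _ _ _ _ _ _ _ _ _ ⟨?_⟩
  rintro _ _ ⟨e, ⟨b, rfl⟩, f, hf, rfl⟩ ⟨e', ⟨b', rfl⟩, f', hf', rfl⟩
  have k1 := key b b' f f' hf hf'
  have k2 := key b' b f' f hf' hf
  have := OpenPartialHomeomorph.mem_maximalAtlas_of_contMDiffOn (I := IB.prod IF) (n := ∞)
    (((A.triv b).toOpenPartialHomeomorph ≫ₕ f).symm ≫ₕ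
          ((A.triv b').toOpenPartialHomeomorph ≫ₕ f')) k1 (by
      simpa [OpenPartialHomeomorph.trans_symm_eq_symm_trans_symm] using k2)
  have h := (contDiffGroupoid ∞ (IB.prod IF)).compatible_of_mem_maximalAtlas
    ((contDiffGroupoid ∞ (IB.prod IF)).id_mem_maximalAtlas) this
  simpa using h

theorem isSmoothTrivialization [IsManifold IB ∞ B] [IsManifold IF ∞ F] (b : B) :
    letI := A.chartedSpace
    IsSmoothTrivialization (IB.prod IF) IB IF (A.triv b) := by
  let := A.chartedSpaceProd
  let := A.chartedSpace
  have := A.isManifold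
  constructor
  · intro z hz
    set e := (A.triv b).toOpenPartialHomeomorph with he
    set e₀ := (A.triv (π z)).toOpenPartialHomeomorph with he₀
    set f := chartAt (ModelProd HB HF) (e₀ z) with hf
    have hz₀ : z ∈ e₀.source := (A.triv (π z)).mem_source.2 (A.mem_baseSet _)
    have h1 := contMDiffOn_symm_of_mem_maximalAtlas (I := IB.prod IF) (n := ∞)
      (IsManifold.chart_mem_maximalAtlas (e₀ z))
    have h2 := contMDiffOn_of_mem_maximalAtlas (I := IB.prod IF) (n := ∞)
      (IsManifold.chart_mem_maximalAtlas z)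
    have h3 : ContMDiffOn (IB.prod IF) (IB.prod IF) ∞ (e₀.symm ≫ₕ e) (e₀.symm ≫ₕ e).source :=
      A.smooth_transition (π z) b
    have hc : chartAt (ModelProd HB HF) z = e₀ ≫ₕ f := rfl
    rw [hc] at h2
    have hmaps : MapsTo (e₀ ≫ₕ f) ((e₀ ≫ₕ f).source ∩ e.source)
        (f.target ∩ f.symm ⁻¹' (e₀.symm ≫ₕ e).source) := by
      rintro x ⟨hx, hx'⟩
      simp only [mfld_simps] at hx ⊢
      simp [hx.1, hx.2, hx']
    have h5 : ContMDiffOn (IB.prod IF) (IB.prod IF) ∞ (fun x => (e₀.symm ≫ₕ e) (f.symm x))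
        (f.target ∩ f.symm ⁻¹' (e₀.symm ≫ₕ e).source) :=
      h3.comp (h1.mono inter_subset_left) (fun x hx => hx.2)
    have h4 := h5.comp (h2.mono inter_subset_left) hmaps
    have hn : (e₀ ≫ₕ f).source ∩ e.source ∈ 𝓝 z :=
      ((e₀ ≫ₕ f).open_source.inter e.open_source).mem_nhds
        ⟨by simp [hz₀, hf], hz⟩
    refine ContMDiffAt.contMDiffWithinAt ((h4.contMDiffAt hn).congr_of_eventuallyEq ?_)
    filter_upwards [hn] with x hx
    have := hx.1
    simp only [mfld_simps] at this
    simp [this.1, this.2]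
    rfl
  · intro y hy
    set e := (A.triv b).toOpenPartialHomeomorph with he
    set z := e.symm y with hzdef
    have hz : z ∈ e.source := e.map_target hy
    set e₀ := (A.triv (π z)).toOpenPartialHomeomorph with he₀
    set f := chartAt (ModelProd HB HF) (e₀ z) with hf
    have hz₀ : z ∈ e₀.source := (A.triv (π z)).mem_source.2 (A.mem_baseSet _)
    have h1 := contMDiffOn_of_mem_maximalAtlas (I := IB.prod IF) (n := ∞)
      (IsManifold.chart_mem_maximalAtlas (e₀ z))
    have h2 := contMDiffOn_symm_of_mem_maximalAtlas (I := IB.prod IF) (n := ∞)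
      (IsManifold.chart_mem_maximalAtlas z)
    have h3 : ContMDiffOn (IB.prod IF) (IB.prod IF) ∞ (e.symm ≫ₕ e₀) (e.symm ≫ₕ e₀).source :=
      A.smooth_transition b (π z)
    have hc : chartAt (ModelProd HB HF) z = e₀ ≫ₕ f := rfl
    rw [hc] at h2
    have hmaps : MapsTo (fun x => f ((e.symm ≫ₕ e₀) x))
        ((e.symm ≫ₕ e₀).source ∩ (e.symm ≫ₕ e₀) ⁻¹' f.source) (e₀ ≫ₕ f).target := by
      rintro x ⟨hx, hx'⟩
      simp only [mfld_simps] at hx hx' ⊢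
      simp [hx.2, hx']
    have h5 : ContMDiffOn (IB.prod IF) (IB.prod IF) ∞ (fun x => f ((e.symm ≫ₕ e₀) x))
        ((e.symm ≫ₕ e₀).source ∩ (e.symm ≫ₕ e₀) ⁻¹' f.source) :=
      h1.comp (h3.mono inter_subset_left) (fun x hx => hx.2)
    have h4 := h2.comp h5 hmaps
    have hn : (e.symm ≫ₕ e₀).source ∩ (e.symm ≫ₕ e₀) ⁻¹' f.source ∈ 𝓝 y :=
      ((e.symm ≫ₕ e₀).isOpen_inter_preimage f.open_source).mem_nhds
        ⟨by simpa [hy] using hz₀, by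
          simp [hf, hzdef]⟩
    refine ContMDiffAt.contMDiffWithinAt ((h4.contMDiffAt hn).congr_of_eventuallyEq ?_)
    filter_upwards [hn] with x hx
    have := hx.1
    have h' := hx.2
    simp only [mfld_simps] at this h'
    simp [this.2, h']

theorem isSmoothFiberBundle [IsManifold IB ∞ B] [IsManifold IF ∞ F] :
    letI := A.chartedSpace
    IsSmoothFiberBundle (IB.prod IF) IB IF F π :=
  fun b => ⟨A.triv b, A.mem_baseSet b, A.isSmoothTrivialization b⟩

end BundleAtlas

/-! ### Pull-back bundles -/

section Pullback

variable {IZ IB IF}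

namespace IsSmoothFiberBundle

variable [ChartedSpace HZ Z] (hπ : IsSmoothFiberBundle IZ IB IF F π)

/-- A chosen smooth local trivialization around a point of the base. -/
def triv (b : B) : Bundle.Trivialization F π := (hπ b).choose

theorem mem_baseSet (b : B) : b ∈ (hπ.triv b).baseSet := (hπ b).choose_spec.1

theorem isSmoothTrivialization (b : B) : IsSmoothTrivialization IZ IB IF (hπ.triv b) :=
  (hπ b).choose_spec.2

end IsSmoothFiberBundle

variable {EB' HB' : Type*} [NormedAddCommGroup EB'] [NormedSpace ℝ EB'] [TopologicalSpace HB']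
  {IB' : ModelWithCorners ℝ EB' HB'} {B' : Type*} [TopologicalSpace B'] [ChartedSpace HB' B']
  [ChartedSpace HZ Z]

/-- The pull-back `f^* Z = {(b', z) | f b' = π z} ⊆ B' × Z` of a smooth fibre bundle `π : Z → B`
along a smooth map `f : B' → B`. -/
@[ext] structure BundlePullback (hπ : IsSmoothFiberBundle IZ IB IF F π) (f : C^∞⟮IB', B'; IB, B⟯) where
  /-- The projection `f^* Z → B'`. -/
  proj : B'
  /-- The canonical bundle morphism `f^* Z → Z` covering `f`. -/
  toTotal : Z
  condition : f proj = π toTotal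

namespace BundlePullback

variable (hπ : IsSmoothFiberBundle IZ IB IF F π) (f : C^∞⟮IB', B'; IB, B⟯)

/-- The topology of a subspace of `B' × Z`. -/
instance : TopologicalSpace (BundlePullback hπ f) :=
  TopologicalSpace.induced (fun x => (x.proj, x.toTotal)) inferInstance

theorem continuous_prod : Continuous (fun x : BundlePullback hπ f => (x.proj, x.toTotal)) :=
  continuous_induced_dom

theorem continuous_proj : Continuous (proj : BundlePullback hπ f → B') :=
  continuous_fst.comp (continuous_prod hπ f)

theorem continuous_toTotal : Continuous (toTotal : BundlePullback hπ f → Z) :=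
  continuous_snd.comp (continuous_prod hπ f)

open Classical in
/-- The inverse `(b', v) ↦ (b', e.symm (f b', v))` of the induced trivialization, extended
arbitrarily outside of its domain. -/
def pullInv (e : Bundle.Trivialization F π) (y : B' × F) : BundlePullback hπ f where
  proj := y.1
  toTotal := if f y.1 ∈ e.baseSet then e.toOpenPartialHomeomorph.symm (f y.1, y.2)
    else (hπ.triv (f y.1)).toOpenPartialHomeomorph.symm (f y.1, y.2)
  condition := by
    split_ifs with h
    · exact (e.proj_symm_apply' h).symm
    · exact ((hπ.triv (f y.1)).proj_symm_apply' (hπ.mem_baseSet _)).symm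

theorem toTotal_pullInv (e : Bundle.Trivialization F π) {y : B' × F} (hy : f y.1 ∈ e.baseSet) :
    (pullInv hπ f e y).toTotal = e.toOpenPartialHomeomorph.symm (f y.1, y.2) := if_pos hy

/-- The trivialization `(b', z) ↦ (b', pr₂ (e z))` of `f^* Z` induced by a trivialization `e`
of `Z`. -/
def pullTriv (e : Bundle.Trivialization F π) :
    Bundle.Trivialization F (proj : BundlePullback hπ f → B') where
  toFun x := (x.proj, (e x.toTotal).2)
  invFun := pullInv hπ f e
  source := proj ⁻¹' (f ⁻¹' e.baseSet)
  target := (f ⁻¹' e.baseSet) ×ˢ univ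
  map_source' x hx := ⟨hx, mem_univ _⟩
  map_target' y hy := hy.1
  left_inv' x hx := by
    have h : f x.proj ∈ e.baseSet := hx
    have h2 : x.toTotal ∈ e.source := e.mem_source.2 (x.condition ▸ h)
    refine BundlePullback.ext rfl ?_
    rw [toTotal_pullInv hπ f e h]
    simp only [x.condition]
    exact e.symm_apply_mk_proj h2
  right_inv' y hy := by
    have h : f y.1 ∈ e.baseSet := hy.1
    rw [toTotal_pullInv hπ f e h, e.apply_symm_apply' h]
    rfl
  open_source := (e.open_baseSet.preimage f.contMDiff.continuous).preimage (continuous_proj hπ f)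
  open_target := (e.open_baseSet.preimage f.contMDiff.continuous).prod isOpen_univ
  continuousOn_toFun := by
    refine (continuous_proj hπ f).continuousOn.prodMk (continuous_snd.comp_continuousOn
      (e.continuousOn_toFun.comp (continuous_toTotal hπ f).continuousOn ?_))
    intro x hx
    exact e.mem_source.2 (x.condition ▸ hx)
  continuousOn_invFun := by
    have h : IsInducing (fun x : BundlePullback hπ f => (x.proj, x.toTotal)) := ⟨rfl⟩
    rw [h.continuousOn_iff]
    refine continuous_fst.continuousOn.prodMk
      (ContinuousOn.congr (f := fun y => e.toOpenPartialHomeomorph.symm (f y.1, y.2)) ?_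
        (fun y hy => toTotal_pullInv hπ f e hy.1))
    exact e.continuousOn_invFun.comp
      ((f.contMDiff.continuous.comp continuous_fst).prodMk continuous_snd).continuousOn
      (fun y hy => e.mem_target.2 hy.1)
  baseSet := f ⁻¹' e.baseSet
  open_baseSet := e.open_baseSet.preimage f.contMDiff.continuous
  source_eq := rfl
  target_eq := rfl
  proj_toFun _ _ := rfl

/-- The atlas of induced trivializations of `f^* Z`. -/
def bundleAtlas : BundleAtlas IB' IF F (proj : BundlePullback hπ f → B') where
  triv b := pullTriv hπ f (hπ.triv (f b))
  mem_baseSet b := hπ.mem_baseSet (f b)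
  smooth_transition b b' := by
    set e := hπ.triv (f b) with he
    set e' := hπ.triv (f b') with he'
    have hs : ∀ y ∈ ((pullTriv hπ f e).toOpenPartialHomeomorph.symm ≫ₕ
        (pullTriv hπ f e').toOpenPartialHomeomorph).source,
        f y.1 ∈ e.baseSet ∧ f y.1 ∈ e'.baseSet := fun y hy => ⟨hy.1.1, hy.2⟩
    have hg : ContMDiff (IB'.prod IF) (IB.prod IF) ∞ (fun y : B' × F => (f y.1, y.2)) :=
      (f.contMDiff.comp contMDiff_fst).prodMk contMDiff_snd
    have h := contMDiff_snd.comp_contMDiffOn ((hπ.isSmoothTrivialization (f b')).contMDiffOn_toFun.comp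
      ((hπ.isSmoothTrivialization (f b)).contMDiffOn_invFun.comp
        (s := {y : B' × F | f y.1 ∈ e.baseSet ∧ f y.1 ∈ e'.baseSet}) hg.contMDiffOn
        (fun y hy => e.mem_target.2 hy.1))
      (fun y hy => e'.mem_source.2 (by
        change π (e.toOpenPartialHomeomorph.symm (f y.1, y.2)) ∈ e'.baseSet
        rw [e.proj_symm_apply' hy.1]; exact hy.2)))
    refine ((contMDiff_fst.contMDiffOn.prodMk h).mono hs).congr ?_
    intro y hy
    refine Prod.ext rfl ?_
    change (e' (pullInv hπ f e y).toTotal).2 = _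
    rw [toTotal_pullInv hπ f e (hs y hy).1]
    rfl

instance : ChartedSpace (ModelProd HB' HF) (BundlePullback hπ f) := (bundleAtlas hπ f).chartedSpace

instance [IsManifold IB' ∞ B'] [IsManifold IF ∞ F] :
    IsManifold (IB'.prod IF) ∞ (BundlePullback hπ f) := (bundleAtlas hπ f).isManifold

theorem isSmoothFiberBundle [IsManifold IB' ∞ B'] [IsManifold IF ∞ F] :
    IsSmoothFiberBundle (IB'.prod IF) IB' IF F (proj : BundlePullback hπ f → B') := (bundleAtlas hπ f).isSmoothFiberBundle

end BundlePullback

end Pullback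

end Bundles

/-! ### Principal bundles and associated bundles -/

section Principal

variable {EP HP : Type*} [NormedAddCommGroup EP] [NormedSpace ℝ EP] [TopologicalSpace HP]
  {EB HB : Type*} [NormedAddCommGroup EB] [NormedSpace ℝ EB] [TopologicalSpace HB]
  {EK HK : Type*} [NormedAddCommGroup EK] [NormedSpace ℝ EK] [TopologicalSpace HK]
  {EV HV : Type*} [NormedAddCommGroup EV] [NormedSpace ℝ EV] [TopologicalSpace HV]
  {IP : ModelWithCorners ℝ EP HP} {IB : ModelWithCorners ℝ EB HB}
  {IK : ModelWithCorners ℝ EK HK} {IV : ModelWithCorners ℝ EV HV}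
  {P : Type*} [TopologicalSpace P] [ChartedSpace HP P]
  {B : Type*} [TopologicalSpace B] [ChartedSpace HB B]
  {K : Type*} [TopologicalSpace K] [ChartedSpace HK K] [Group K]
  {V : Type*} [TopologicalSpace V] [ChartedSpace HV V] [MulAction K V]
  {act : P → K → P} {π : P → B}

variable (IP IB IK act π) in
/-- `π : P → B` is a principal bundle with structure group `K` acting on `P` on the right
by `p g = act p g`: around every point of `B` there is a smooth local trivialization
`π ⁻¹ U ≃ U × K` which is equivariant for right multiplications. In particular the action is free
and its orbits are the fibres of `π`, i.e. `B = P / K`. -/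
structure IsPrincipalBundle : Prop where
  act_one : ∀ p, act p 1 = p
  act_mul : ∀ p g g', act p (g * g') = act (act p g) g'
  contMDiff_act : ContMDiff (IP.prod IK) IP ∞ (fun x : P × K => act x.1 x.2)
  proj_act : ∀ p g, π (act p g) = π p
  exists_triv : ∀ b : B, ∃ e : Bundle.Trivialization K π, b ∈ e.baseSet ∧
    IsSmoothTrivialization IP IB IK e ∧
    ∀ p ∈ e.source, ∀ g, (e (act p g)).2 = (e p).2 * g

namespace IsPrincipalBundle

variable (hq : IsPrincipalBundle IP IB IK act π)

theorem isSmoothFiberBundle (hq : IsPrincipalBundle IP IB IK act π) : IsSmoothFiberBundle IP IB IK K π := fun b =>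
  let ⟨e, h, he, _⟩ := hq.exists_triv b
  ⟨e, h, he⟩

/-- A chosen equivariant smooth local trivialization around a point of the base. -/
def triv (b : B) : Bundle.Trivialization K π := (hq.exists_triv b).choose

theorem mem_baseSet (b : B) : b ∈ (hq.triv b).baseSet := (hq.exists_triv b).choose_spec.1

theorem isSmoothTrivialization (b : B) : IsSmoothTrivialization IP IB IK (hq.triv b) :=
  (hq.exists_triv b).choose_spec.2.1

theorem triv_act (b : B) {p : P} (hp : p ∈ (hq.triv b).source) (g : K) :
    (hq.triv b (act p g)).2 = (hq.triv b p).2 * g :=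
  (hq.exists_triv b).choose_spec.2.2 p hp g

theorem contMDiff_proj (hq : IsPrincipalBundle IP IB IK act π) : ContMDiff IP IB ∞ π := by
  intro p
  have h := (hq.isSmoothTrivialization (π p)).contMDiffOn_toFun
  have hn : (hq.triv (π p)).source ∈ 𝓝 p :=
    (hq.triv (π p)).open_source.mem_nhds ((hq.triv (π p)).mem_source.2 (hq.mem_baseSet _))
  refine ((contMDiff_fst.comp_contMDiffOn h).contMDiffAt hn).congr_of_eventuallyEq ?_
  filter_upwards [hn] with x hx
  exact ((hq.triv (π p)).coe_fst hx).symm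

theorem act_triv_symm (b : B) {p : P} (hp : p ∈ (hq.triv b).source) :
    act ((hq.triv b).toOpenPartialHomeomorph.symm (π p, 1)) (hq.triv b p).2 = p := by
  have hb : π p ∈ (hq.triv b).baseSet := (hq.triv b).mem_source.1 hp
  have hz : (hq.triv b).toOpenPartialHomeomorph.symm (π p, 1) ∈ (hq.triv b).source :=
    (hq.triv b).toOpenPartialHomeomorph.map_target ((hq.triv b).mem_target.2 hb)
  have hz' : act ((hq.triv b).toOpenPartialHomeomorph.symm (π p, 1)) (hq.triv b p).2 ∈
      (hq.triv b).source := by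
    rw [(hq.triv b).mem_source, hq.proj_act, (hq.triv b).proj_symm_apply' hb]; exact hb
  refine (hq.triv b).toOpenPartialHomeomorph.injOn hz' hp ?_
  refine Prod.ext ?_ ?_
  · change (hq.triv b _).1 = (hq.triv b _).1
    rw [(hq.triv b).coe_fst hz', (hq.triv b).coe_fst hp, hq.proj_act,
      (hq.triv b).proj_symm_apply' hb]
  · change (hq.triv b _).2 = (hq.triv b _).2
    rw [hq.triv_act b hz, (hq.triv b).apply_symm_apply' hb, one_mul]

/-- The equivalence relation `(p, v) ∼ (p g, g⁻¹ v)` on `P × V`. -/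
def assocSetoid (V : Type*) [MulAction K V] : Setoid (P × V) where
  r x y := ∃ g : K, y = (act x.1 g, g⁻¹ • x.2)
  iseqv := by
    refine ⟨fun x => ⟨1, by simp [hq.act_one]⟩, ?_, ?_⟩
    · rintro x _ ⟨g, rfl⟩
      exact ⟨g⁻¹, by simp [← hq.act_mul, hq.act_one]⟩
    · rintro x _ _ ⟨g, rfl⟩ ⟨g', rfl⟩
      exact ⟨g * g', by simp [hq.act_mul, mul_smul]⟩

end IsPrincipalBundle

/-- The associated bundle `(P × V) / K`, where `(p, v) ∼ (p g, g⁻¹ v)`. -/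
def AssocBundle (_IV : ModelWithCorners ℝ EV HV) (hq : IsPrincipalBundle IP IB IK act π)
    (V : Type*) [TopologicalSpace V] [ChartedSpace HV V] [MulAction K V] : Type _ :=
  Quotient (hq.assocSetoid V)

namespace AssocBundle

variable (IV) (hq : IsPrincipalBundle IP IB IK act π)

variable (V) in
/-- The canonical map `P × V → (P × V) / K`. -/
def mk (x : P × V) : AssocBundle IV hq V := Quotient.mk (hq.assocSetoid V) x

/-- The quotient topology. -/
instance : TopologicalSpace (AssocBundle IV hq V) :=
  inferInstanceAs (TopologicalSpace (Quotient (hq.assocSetoid V)))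

variable (V) in
/-- The projection `(P × V) / K → B`. -/
def proj : AssocBundle IV hq V → B :=
  Quotient.lift (fun x => π x.1) (by rintro x _ ⟨g, rfl⟩; exact (hq.proj_act _ _).symm)

theorem isQuotientMap_mk : IsQuotientMap (mk IV V hq) := isQuotientMap_quotient_mk'

theorem mk_act (p : P) (v : V) (g : K) : mk IV V hq (act p g, g⁻¹ • v) = mk IV V hq (p, v) :=
  (Quotient.sound (s := hq.assocSetoid V) (a := (p, v)) ⟨g, rfl⟩).symm

theorem continuous_proj : Continuous (proj IV V hq) :=
  (isQuotientMap_mk IV hq).continuous_iff.2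
    (hq.contMDiff_proj.continuous.comp continuous_fst)

/-- The map `[p, v] ↦ (π p, pr₂ (e p) v)`, where `e` is the chosen local trivialization at `b`. -/
def trivFun (b : B) (y : AssocBundle IV hq V) : B × V :=
  (proj IV V hq y, (hq.triv b (Quotient.out y).1).2 • (Quotient.out y).2)

theorem trivFun_mk (b : B) {p : P} (hp : π p ∈ (hq.triv b).baseSet) (v : V) :
    trivFun IV hq b (mk IV V hq (p, v)) = (π p, (hq.triv b p).2 • v) := by
  refine Prod.ext rfl ?_
  obtain ⟨g, hg⟩ := Quotient.mk_out (s := hq.assocSetoid V) (p, v)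
  change (hq.triv b (Quotient.mk (hq.assocSetoid V) (p, v)).out.1).2 •
    (Quotient.mk (hq.assocSetoid V) (p, v)).out.2 = (hq.triv b p).2 • v
  generalize (Quotient.mk (hq.assocSetoid V) (p, v)).out = o at hg
  obtain ⟨rfl, rfl⟩ := Prod.mk.inj hg
  rw [hq.triv_act b ((hq.triv b).mem_source.2 (by rwa [hq.proj_act] at hp)), mul_smul,
    smul_inv_smul]

variable [ContMDiffSMul IK IV ∞ K V] 

/-- The trivialization `[p, v] ↦ (π p, pr₂ (e p) v)` of the associated bundle induced by an
equivariant trivialization of `P`. Its inverse is `(b, v) ↦ [z b, v]`, where `z = e.symm (·, 1)`. -/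
def assocTriv (b : B) : Bundle.Trivialization V (proj IV V hq) where
  toFun := trivFun IV hq b
  invFun y := mk IV V hq ((hq.triv b).toOpenPartialHomeomorph.symm (y.1, 1), y.2)
  source := proj IV V hq ⁻¹' (hq.triv b).baseSet
  target := (hq.triv b).baseSet ×ˢ univ
  map_source' y hy := ⟨hy, mem_univ _⟩
  map_target' y hy := by
    change π ((hq.triv b).toOpenPartialHomeomorph.symm (y.1, 1)) ∈ (hq.triv b).baseSet
    rw [(hq.triv b).proj_symm_apply' hy.1]
    exact hy.1
  left_inv' y hy := by
    obtain ⟨⟨p, v⟩, rfl⟩ := Quotient.exists_rep y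
    have hp : π p ∈ (hq.triv b).baseSet := hy
    change mk IV V hq ((hq.triv b).toOpenPartialHomeomorph.symm
      ((trivFun IV hq b (mk IV V hq (p, v))).1, 1), (trivFun IV hq b (mk IV V hq (p, v))).2) =
      mk IV V hq (p, v)
    rw [trivFun_mk IV hq b hp, ← mk_act IV hq _ _ (hq.triv b p).2,
      hq.act_triv_symm b ((hq.triv b).mem_source.2 hp), inv_smul_smul]
  right_inv' y hy := by
    rw [trivFun_mk IV hq b (by rw [(hq.triv b).proj_symm_apply' hy.1]; exact hy.1),
      (hq.triv b).proj_symm_apply' hy.1, (hq.triv b).apply_symm_apply' hy.1, one_smul]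
  open_source := (hq.triv b).open_baseSet.preimage (continuous_proj IV hq)
  open_target := (hq.triv b).open_baseSet.prod isOpen_univ
  continuousOn_toFun := by
    rw [(isQuotientMap_mk IV hq).continuousOn_isOpen_iff
      ((hq.triv b).open_baseSet.preimage (continuous_proj IV hq))]
    have hsmul : Continuous (fun x : K × V => x.1 • x.2) :=
      (ContMDiffSMul.contMDiff_smul (I := IK) (I' := IV) (n := ∞) (G := K) (M := V)).continuous
    have h1 : ContinuousOn (fun x : P × V => hq.triv b x.1)
        (mk IV V hq ⁻¹' (proj IV V hq ⁻¹' (hq.triv b).baseSet)) :=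
      (hq.triv b).continuousOn_toFun.comp continuousOn_fst
        (fun x hx => (hq.triv b).mem_source.2 hx)
    refine ((hq.contMDiff_proj.continuous.comp continuous_fst).continuousOn.prodMk
      (hsmul.comp_continuousOn ((continuous_snd.comp_continuousOn h1).prodMk
        continuousOn_snd))).congr ?_
    rintro ⟨p, v⟩ hp
    exact trivFun_mk IV hq b hp v
  continuousOn_invFun := by
    refine (isQuotientMap_mk IV hq).continuous.comp_continuousOn
      (ContinuousOn.prodMk ?_ continuousOn_snd)
    exact (hq.triv b).continuousOn_invFun.comp
      (continuous_fst.prodMk continuous_const).continuousOn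
      (fun y hy => (hq.triv b).mem_target.2 hy.1)
  baseSet := (hq.triv b).baseSet
  open_baseSet := (hq.triv b).open_baseSet
  source_eq := rfl
  target_eq := rfl
  proj_toFun _ _ := rfl

/-- The atlas of induced trivializations of the associated bundle. -/
def bundleAtlas : BundleAtlas IB IV V (proj IV V hq) where
  triv := assocTriv IV hq
  mem_baseSet := hq.mem_baseSet
  smooth_transition b b' := by
    have hs : ∀ y ∈ ((assocTriv IV hq b : Bundle.Trivialization V
          (proj IV V hq)).toOpenPartialHomeomorph.symm ≫ₕ
        (assocTriv IV hq b').toOpenPartialHomeomorph).source,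
        y.1 ∈ (hq.triv b).baseSet ∧ y.1 ∈ (hq.triv b').baseSet := by
      intro y hy
      refine ⟨hy.1.1, ?_⟩
      have h : π ((hq.triv b).toOpenPartialHomeomorph.symm (y.1, 1)) ∈ (hq.triv b').baseSet := hy.2
      rwa [(hq.triv b).proj_symm_apply' hy.1.1] at h
    have hg : ContMDiff (IB.prod IV) (IB.prod IK) ∞ (fun y : B × V => (y.1, (1 : K))) :=
      contMDiff_fst.prodMk contMDiff_const
    have h := contMDiff_snd.comp_contMDiffOn ((hq.isSmoothTrivialization b').contMDiffOn_toFun.comp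
      ((hq.isSmoothTrivialization b).contMDiffOn_invFun.comp
        (s := {y : B × V | y.1 ∈ (hq.triv b).baseSet ∧ y.1 ∈ (hq.triv b').baseSet})
        hg.contMDiffOn (fun y hy => (hq.triv b).mem_target.2 hy.1))
      (fun y hy => (hq.triv b').mem_source.2 (by
        change π ((hq.triv b).toOpenPartialHomeomorph.symm (y.1, 1)) ∈ (hq.triv b').baseSet
        rw [(hq.triv b).proj_symm_apply' hy.1]; exact hy.2)))
    have h' := (ContMDiffSMul.contMDiff_smul (I := IK) (I' := IV) (n := ∞) (G := K)
      (M := V)).comp_contMDiffOn (h.prodMk contMDiffOn_snd)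
    refine ((contMDiff_fst.contMDiffOn.prodMk h').mono hs).congr ?_
    intro y hy
    obtain ⟨h1, h2⟩ := hs y hy
    change trivFun IV hq b' (mk IV V hq ((hq.triv b).toOpenPartialHomeomorph.symm (y.1, 1), y.2)) = _
    rw [trivFun_mk IV hq b' (by rw [(hq.triv b).proj_symm_apply' h1]; exact h2),
      (hq.triv b).proj_symm_apply' h1]
    rfl

instance : ChartedSpace (ModelProd HB HV) (AssocBundle IV hq V) :=
  (bundleAtlas IV hq).chartedSpace

instance [IsManifold IB ∞ B] [IsManifold IV ∞ V] :
    IsManifold (IB.prod IV) ∞ (AssocBundle IV hq V) := (bundleAtlas IV hq).isManifold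

theorem isSmoothFiberBundle [IsManifold IB ∞ B] [IsManifold IV ∞ V] :
    IsSmoothFiberBundle (IB.prod IV) IB IV V (proj IV V hq) :=
  (bundleAtlas IV hq).isSmoothFiberBundle

end AssocBundle

variable (IP IV act) in
/-- The surjective submersion `k : P × V → Y` presents the manifold `Y` as the quotient `(P × V) / K`
by the equivalence relation `(p, v) ∼ (p g, g⁻¹ v)`, i.e. as the bundle with typical fibre `V`
associated to `P`. -/
structure IsAssociatedBundle {EY HY : Type*} [NormedAddCommGroup EY] [NormedSpace ℝ EY]
    [TopologicalSpace HY] (IY : ModelWithCorners ℝ EY HY) {Y : Type*} [TopologicalSpace Y]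
    [ChartedSpace HY Y] (k : P × V → Y) : Prop where
  contMDiff : ContMDiff (IP.prod IV) IY ∞ k
  surjective : Function.Surjective k
  eq_iff : ∀ x y, k x = k y ↔ ∃ g : K, y = (act x.1 g, g⁻¹ • x.2)
  surjective_mfderiv : ∀ x, Function.Surjective (mfderiv (IP.prod IV) IY k x)

variable (IP IK act) in
/-- The vertical vector at `p` which is the derivative of `p · exp (t ξ)` at `t = 0`,
for `ξ` in the Lie algebra of `K`. -/
def verticalVector (p : P) (ξ : GroupLieAlgebra IK K) : TangentSpace IP p :=
  mfderiv IK IP (fun g : K => act p g) 1 ξ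

variable (IK IV) in
/-- The value at `v` of the vector field on `V` representing `ξ` in the Lie algebra of `K`,
that is the derivative of `exp (t ξ) · v` at `t = 0`. -/
def generator (v : V) (ξ : GroupLieAlgebra IK K) : TangentSpace IV v :=
  mfderiv IK IV (fun g : K => g • v) 1 ξ

section PullbackOfBundles

variable {EB' HB' : Type*} [NormedAddCommGroup EB'] [NormedSpace ℝ EB'] [TopologicalSpace HB']
  {IB' : ModelWithCorners ℝ EB' HB'} {B' : Type*} [TopologicalSpace B'] [ChartedSpace HB' B']
  (hq : IsPrincipalBundle IP IB IK act π) (f : C^∞⟮IB', B'; IB, B⟯)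

/-- The pull-back `f^* P` of a principal bundle. -/
abbrev PrincipalPullback : Type _ := BundlePullback hq.isSmoothFiberBundle f

/-- The right action of the structure group on `f^* P`. -/
def PrincipalPullback.rightAct (x : PrincipalPullback hq f) (g : K) : PrincipalPullback hq f where
  proj := x.proj
  toTotal := act x.toTotal g
  condition := x.condition.trans (hq.proj_act _ _).symm

open Classical in
/-- The local section `z ∘ f` of `f^* P` induced by a local section `z` of `P`
(with an arbitrary value at the points where `z` is not a section). -/
def PrincipalPullback.sectionPullback (z : B → P) (x : B') : PrincipalPullback hq f :=
  if h : f x = π (z (f x)) then ⟨x, z (f x), h⟩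
  else ⟨x, (hq.triv (f x)).toOpenPartialHomeomorph.symm (f x, 1),
    ((hq.triv (f x)).proj_symm_apply' (hq.mem_baseSet _)).symm⟩

variable (IV V) [IsManifold IB ∞ B] [IsManifold IV ∞ V] [ContMDiffSMul IK IV ∞ K V]

/-- The pull-back `f^* Y` of the associated bundle `Y = (P × V) / K`. -/
abbrev AssocPullback : Type _ := BundlePullback (AssocBundle.isSmoothFiberBundle (V := V) IV hq) f

/-- The canonical map `f^* P × V → f^* Y`. -/
def AssocPullback.mk (x : PrincipalPullback hq f × V) : AssocPullback IV V hq f where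
  proj := x.1.proj
  toTotal := AssocBundle.mk IV V hq (x.1.toTotal, x.2)
  condition := x.1.condition

end PullbackOfBundles

end Principal

/-! ### Connections -/

section Connections

variable {EZ HZ : Type*} [NormedAddCommGroup EZ] [NormedSpace ℝ EZ] [TopologicalSpace HZ]
  (IZ : ModelWithCorners ℝ EZ HZ)
  {EB HB : Type*} [NormedAddCommGroup EB] [NormedSpace ℝ EB] [TopologicalSpace HB]
  (IB : ModelWithCorners ℝ EB HB)
  {Z B : Type*} [TopologicalSpace Z] [ChartedSpace HZ Z] [TopologicalSpace B] [ChartedSpace HB B]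

/-- A connection on a fibre bundle `π : Z → B`: a smooth section of the jet bundle `J¹Z → Z`, that is
a splitting `T_{π z} B → T_z Z` of the tangent map of `π` at every point `z`, depending
smoothly on `z`. -/
@[ext] structure Connection [IsManifold IZ ∞ Z] [IsManifold IB ∞ B] (π : Z → B) where
  /-- the horizontal lift of tangent vectors -/
  lift : ∀ z : Z, TangentSpace IB (π z) →L[ℝ] TangentSpace IZ z
  mfderiv_lift : ∀ z u, mfderiv IZ IB π z (lift z u) = u
  smooth_lift : ∀ z₀ : Z, ContMDiffAt IZ 𝓘(ℝ, EB →L[ℝ] EZ) ∞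
    (inTangentCoordinates IB IZ π _root_.id lift z₀) z₀

variable {IZ IB} [IsManifold IZ ∞ Z] [IsManifold IB ∞ B] {π : Z → B}

/-- A connection on a principal bundle is principal if it is equivariant for the right action of
the structure group. (Here `u` is a tangent vector at the point `π (z g) = π z`.) -/
def Connection.IsPrincipal {K : Type*} (act : Z → K → Z) (Γ : Connection IZ IB π) : Prop :=
  ∀ (z : Z) (g : K) (u : TangentSpace IB (π z)),
    mfderiv IZ IZ (fun z' => act z' g) z (Γ.lift z u) = Γ.lift (act z g) u

/-- Given the canonical map `k : Z × V → Y` of a principal bundle `Z → B` to an associated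
bundle `Y → B`, the connection `Δ` on `Y` is associated to the principal connection `Γ` on `Z`:
its horizontal lifts at `k (z, v)` are the images of those of `Γ` at `z` under the
tangent map of `k (·, v)`. (Here `u` is a tangent vector at `πY (k (z, v)) = π z`.) -/
def Connection.IsAssociated {V : Type*}
    {EY HY : Type*} [NormedAddCommGroup EY] [NormedSpace ℝ EY] [TopologicalSpace HY]
    {IY : ModelWithCorners ℝ EY HY} {Y : Type*} [TopologicalSpace Y] [ChartedSpace HY Y]
    [IsManifold IY ∞ Y] {πY : Y → B} (k : Z × V → Y)
    (Γ : Connection IZ IB π) (Δ : Connection IY IB πY) : Prop :=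
  ∀ (z : Z) (v : V) (u : TangentSpace IB (π z)),
    mfderiv IZ IY (fun z' => k (z', v)) z (Γ.lift z u) = Δ.lift (k (z, v)) u

/-- The connection `Γ'` on `π' : Z' → B'` is the pull-back of the connection `Γ` on `π : Z → B`
with respect to a bundle morphism `F : Z' → Z` covering `f : B' → B`: the tangent map of `F` sends
horizontal lifts of `u` to horizontal lifts of `Tf u`. -/
def Connection.IsPullback {EZ' HZ' : Type*} [NormedAddCommGroup EZ'] [NormedSpace ℝ EZ']
    [TopologicalSpace HZ'] {IZ' : ModelWithCorners ℝ EZ' HZ'}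
    {EB' HB' : Type*} [NormedAddCommGroup EB'] [NormedSpace ℝ EB'] [TopologicalSpace HB']
    {IB' : ModelWithCorners ℝ EB' HB'}
    {Z' B' : Type*} [TopologicalSpace Z'] [ChartedSpace HZ' Z'] [TopologicalSpace B']
    [ChartedSpace HB' B'] [IsManifold IZ' ∞ Z'] [IsManifold IB' ∞ B'] {π' : Z' → B'}
    (F : Z' → Z) (f : B' → B) (Γ' : Connection IZ' IB' π') (Γ : Connection IZ IB π) : Prop :=
  ∀ (z : Z') (u : TangentSpace IB' (π' z)),
    mfderiv IZ' IZ F z (Γ'.lift z u) = Γ.lift (F z) (mfderiv IB' IB f (π' z) u)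

end Connections

/-! ### Local coordinates -/

section Coordinates

variable {EM HM : Type*} [NormedAddCommGroup EM] [NormedSpace ℝ EM] [TopologicalSpace HM]
  {EN HN : Type*} [NormedAddCommGroup EN] [NormedSpace ℝ EN] [TopologicalSpace HN]
  (IM : ModelWithCorners ℝ EM HM) (IN : ModelWithCorners ℝ EN HN)
  {M N : Type*} [TopologicalSpace M] [ChartedSpace HM M] [TopologicalSpace N] [ChartedSpace HN N]

/-- `φ` is a smooth local coordinate system on `M` with values in the normed space `E`. -/
def IsSmoothChart {E : Type*} [NormedAddCommGroup E] [NormedSpace ℝ E]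
    (φ : OpenPartialHomeomorph M E) : Prop :=
  ContMDiffOn IM 𝓘(ℝ, E) ∞ φ φ.source ∧ ContMDiffOn 𝓘(ℝ, E) IM ∞ φ.symm φ.target

/-- The coordinate system `χ` on `N` is fibred over the coordinate system `φ` on `M` with respect to
`π : N → M`: it has the form `(x, s)`, where `x` are the coordinates `φ` of the projection. -/
def IsFibredChart {E E' : Type*} [TopologicalSpace E] [TopologicalSpace E'] (π : N → M)
    (φ : OpenPartialHomeomorph M E) (χ : OpenPartialHomeomorph N (E × E')) : Prop :=
  ∀ y ∈ χ.source, π y ∈ φ.source ∧ (χ y).1 = φ (π y)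

/-- `z` is a smooth section of `π : N → M` over the open set `U`. -/
def IsLocalSection (π : N → M) (U : Set M) (z : M → N) : Prop :=
  IsOpen U ∧ ContMDiffOn IM IN ∞ z U ∧ ∀ x ∈ U, π (z x) = x

end Coordinates

section LocalComponents

variable {EP HP : Type*} [NormedAddCommGroup EP] [NormedSpace ℝ EP] [TopologicalSpace HP]
  {IP : ModelWithCorners ℝ EP HP}
  {EB HB : Type*} [NormedAddCommGroup EB] [NormedSpace ℝ EB] [TopologicalSpace HB]
  {IB : ModelWithCorners ℝ EB HB}
  {EK HK : Type*} [NormedAddCommGroup EK] [NormedSpace ℝ EK] [TopologicalSpace HK]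
  {IK : ModelWithCorners ℝ EK HK}
  {EV HV : Type*} [NormedAddCommGroup EV] [NormedSpace ℝ EV] [TopologicalSpace HV]
  {IV : ModelWithCorners ℝ EV HV}
  {P : Type*} [TopologicalSpace P] [ChartedSpace HP P] [IsManifold IP ∞ P]
  {B : Type*} [TopologicalSpace B] [ChartedSpace HB B] [IsManifold IB ∞ B]
  {K : Type*} [TopologicalSpace K] [ChartedSpace HK K] [Group K]
  {V : Type*} [TopologicalSpace V] [ChartedSpace HV V] [MulAction K V]
  {act : P → K → P} {π : P → B} {n d m r : ℕ}

/-- With respect to coordinates `χ = (x^l, s^j)` on the base `B`, a local section `z` of the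
principal bundle `P` over `U` and a basis `e_a` of the Lie algebra of the structure group, the
connection `Γ` has the components `A^a_l` (`Ax`) and `A^a_j` (`As`), that is
`Γ = dx^l ⊗ (∂_l + A^a_l e_a) + ds^j ⊗ (∂_j + A^a_j e_a)`. Here `∂_l`, `∂_j` on `P` are the images
of the coordinate vector fields under the tangent map of `z`. -/
def HasComponents (act : P → K → P) (Γ : Connection IP IB π)
    (χ : OpenPartialHomeomorph B ((Fin n → ℝ) × (Fin d → ℝ))) (U : Set B) (z : B → P)
    (e : Module.Basis (Fin r) ℝ (GroupLieAlgebra IK K))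
    (Ax : Fin r → Fin n → (Fin n → ℝ) × (Fin d → ℝ) → ℝ)
    (As : Fin r → Fin d → (Fin n → ℝ) × (Fin d → ℝ) → ℝ) : Prop :=
  ∀ y ∈ χ.target, χ.symm y ∈ U →
    (∀ l : Fin n,
      Γ.lift (z (χ.symm y))
        (mfderiv 𝓘(ℝ, (Fin n → ℝ) × (Fin d → ℝ)) IB χ.symm y (Pi.single l 1, 0)) =
      mfderiv 𝓘(ℝ, (Fin n → ℝ) × (Fin d → ℝ)) IP (fun y' => z (χ.symm y')) y (Pi.single l 1, 0) +
        verticalVector IP IK act (z (χ.symm y)) (∑ a, Ax a l y • e a)) ∧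
    (∀ j : Fin d,
      Γ.lift (z (χ.symm y))
        (mfderiv 𝓘(ℝ, (Fin n → ℝ) × (Fin d → ℝ)) IB χ.symm y (0, Pi.single j 1)) =
      mfderiv 𝓘(ℝ, (Fin n → ℝ) × (Fin d → ℝ)) IP (fun y' => z (χ.symm y')) y (0, Pi.single j 1) +
        verticalVector IP IK act (z (χ.symm y)) (∑ a, As a j y • e a))

variable (IV) in
/-- The components `I_a^i` at the point with coordinates `w` of the vector field on `V`
representing the element `e_a` of the Lie algebra, with respect to coordinates `ψ = (y^i)` on `V`. -/
def generatorComponent (ψ : OpenPartialHomeomorph V (Fin m → ℝ))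
    (e : Module.Basis (Fin r) ℝ (GroupLieAlgebra IK K)) (a : Fin r) (i : Fin m)
    (w : Fin m → ℝ) : ℝ :=
  (mfderiv IV 𝓘(ℝ, Fin m → ℝ) ψ (ψ.symm w) (generator IK IV (ψ.symm w) (e a)) : Fin m → ℝ) i

end LocalComponents

end Gauge

end

open Gauge

/-! A connection is a family of horizontal lifts, so each existence claim produces a lift from
geometric data and proves smoothness with the help of local trivializations, while each equality of
lifts is tested on images under suitable tangent maps.

Pull-backs. The space `f^* Z` sits in `B' × Z`, and a trivialization `e` of `Z` gives a local
retraction `(b', z) ↦ (b', e⁻¹(f b', pr₂ (e z)))` onto it. Hence a tangent vector of `f^* Z` is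
determined by its images in `TB'` and `TZ` (`BundlePullback.tangent_ext`), which gives uniqueness.
For existence, the pair consisting of `u` and the lift of `Tf u` is sent through the tangent map of
the retraction. Both members of the pair project to `Tf u` in `TB`, so the retraction changes
neither of them. The same extensionality shows that pull-back preserves principality and
association.

Associated connections. The lift at `[p, v]` is the image of the lift at `p` under the tangent map
of `[·, v]`. Since `[p, v] = [pg, g⁻¹v]`, equivariance makes it independent of the representative
(`AssocBundle.liftAux_congr`). Smooth local sections of `P × V → Y` make it smooth, and surjectivity
of this map gives uniqueness.

Coordinates. Over a local section `z`, the lift of a coordinate vector and its image under `Tz`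
differ by a vertical vector, which comes from the Lie algebra; this gives the components.
Differentiating `[pg, v] = [p, gv]` at `g = 1` turns the vertical vector of `ξ` into the generator
of `ξ` on `V` (`AssocBundle.mfderiv_mk_verticalVector`), whence the formula on `Y`. For the section
`h`, the chain rule gives `Th ∂_l = ∂_l + ∂_l h^j ∂_j`, and linearity of the lift gives the formula
on `Y^h`. -/

noncomputable section

namespace Gauge

/-! ### Tangent maps and families of linear maps in tangent coordinates -/

section Tangent

variable {E H : Type*} [NormedAddCommGroup E] [NormedSpace ℝ E] [TopologicalSpace H]
  {I : ModelWithCorners ℝ E H} {M : Type*} [TopologicalSpace M] [ChartedSpace H M]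
  {E' H' : Type*} [NormedAddCommGroup E'] [NormedSpace ℝ E'] [TopologicalSpace H']
  {I' : ModelWithCorners ℝ E' H'} {M' : Type*} [TopologicalSpace M'] [ChartedSpace H' M']
  {E'' H'' : Type*} [NormedAddCommGroup E''] [NormedSpace ℝ E''] [TopologicalSpace H'']
  {I'' : ModelWithCorners ℝ E'' H''} {M'' : Type*} [TopologicalSpace M''] [ChartedSpace H'' M'']
  {N : Type*}

/-- The chain rule for a map which locally factors, applied to a vector of the model space. -/
theorem mfderiv_apply_of_eventuallyEq_comp {F : M → M''} {g : M' → M''} {f : M → M'} {x : M}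
    {y : M'} (hy : f x = y) (h : F =ᶠ[𝓝 x] g ∘ f) (hg : MDifferentiableAt I' I'' g y)
    (hf : MDifferentiableAt I I' f x) (v : E) :
    (mfderiv I I'' F x v : E'') = mfderiv I' I'' g y (mfderiv I I' f x v : E') := by
  -- Keeping `y` apart from `f x` admits points that agree only propositionally, such as `act p 1`
  -- and `p`; the vectors live in the model spaces so that no transport between tangent spaces is
  -- needed.
  subst hy
  have := (hg.hasMFDerivAt.comp x hf.hasMFDerivAt).congr_of_eventuallyEq h
  exact DFunLike.congr_fun this.mfderiv v

theorem mfderiv_prodMk_apply {f : M → M'} {g : M → M''} {x : M}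
    (hf : MDifferentiableAt I I' f x) (hg : MDifferentiableAt I I'' g x) (v : E) :
    (mfderiv I (I'.prod I'') (fun x => (f x, g x)) x v : E' × E'') =
      ((mfderiv I I' f x v : E'), (mfderiv I I'' g x v : E'')) :=
  DFunLike.congr_fun (mfderiv_prodMk hf hg) v

/-- The chain rule applied to a local left inverse. It yields injectivity of a tangent map from a
smooth local retraction, and surjectivity from a smooth local section. -/
theorem mfderiv_apply_of_eventuallyEq_id {f : M → M'} {g : M' → M} {x : M} {y : M'} (hy : f x = y)
    (h : ∀ᶠ x' in 𝓝 x, g (f x') = x') (hg : MDifferentiableAt I' I g y)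
    (hf : MDifferentiableAt I I' f x) (v : E) :
    (mfderiv I' I g y (mfderiv I I' f x v : E') : E) = v := by
  have := mfderiv_apply_of_eventuallyEq_comp (F := id) (I := I) (I'' := I) hy
    (h.mono fun _ h => h.symm) hg hf v
  rw [← this, mfderiv_id]
  rfl

variable [IsManifold I 1 M] [IsManifold I' 1 M'] [IsManifold I'' 1 M'']

/-- The middle trivialization, centred at `g x₀`, enters once forwards and once backwards. The two
cancel where `g x` stays in its base set, hence only near `x₀` and by continuity of `g`. -/
theorem inTangentCoordinates_comp [TopologicalSpace N] {f : N → M} {g : N → M'} {h : N → M''} (φ : N → E →L[ℝ] E')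
    (ψ : N → E' →L[ℝ] E'') {x₀ : N} (hg : ContinuousAt g x₀) :
    inTangentCoordinates I I'' f h (fun x => (ψ x).comp (φ x)) x₀ =ᶠ[𝓝 x₀] fun x =>
      (inTangentCoordinates I' I'' g h ψ x₀ x).comp (inTangentCoordinates I I' f g φ x₀ x) := by
  have hn := hg.preimage_mem_nhds ((trivializationAt E' (TangentSpace I') (g x₀)).open_baseSet.mem_nhds
    (FiberBundle.mem_baseSet_trivializationAt' (g x₀)))
  filter_upwards [hn] with x hx
  ext v
  exact congrArg (fun w : E' => (Bundle.Trivialization.continuousLinearMapAt ℝ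
      (trivializationAt E'' (TangentSpace I'') (h x₀)) (h x) (ψ x w : E'')))
    (Bundle.Trivialization.symmL_continuousLinearMapAt
      (trivializationAt E' (TangentSpace I') (g x₀)) hx _).symm

theorem inTangentCoordinates_add {f : N → M} {g : N → M'} (φ ψ : N → E →L[ℝ] E') (x₀ x : N) :
    inTangentCoordinates I I' f g (fun x => φ x + ψ x) x₀ x =
      inTangentCoordinates I I' f g φ x₀ x + inTangentCoordinates I I' f g ψ x₀ x := by
  ext v
  exact map_add (Bundle.Trivialization.continuousLinearMapAt ℝ
    (trivializationAt E' (TangentSpace I') (g x₀)) (g x)) _ _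

/-- Equality near `x₀` includes equality at `x₀`, so the reference trivializations coincide as well.
This permits a change of the base-point maps when they agree only locally. -/
theorem inTangentCoordinates_congr [TopologicalSpace N] {f f' : N → M} {g g' : N → M'}
    {φ ψ : N → E →L[ℝ] E'} {x₀ : N} (hf : f =ᶠ[𝓝 x₀] f') (hg : g =ᶠ[𝓝 x₀] g') (h : φ =ᶠ[𝓝 x₀] ψ) :
    inTangentCoordinates I I' f g φ x₀ =ᶠ[𝓝 x₀] inTangentCoordinates I I' f' g' ψ x₀ := by
  filter_upwards [hf, hg, h] with x hx hx' hx''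
  simp only [inTangentCoordinates, hx'', hf.self_of_nhds, hg.self_of_nhds]
  rw [hx, hx']

end Tangent

/-! ### Smoothness of maps read off from a trivialization -/

section Trivializations

variable {EB HB : Type*} [NormedAddCommGroup EB] [NormedSpace ℝ EB] [TopologicalSpace HB]
  {EF HF : Type*} [NormedAddCommGroup EF] [NormedSpace ℝ EF] [TopologicalSpace HF]
  {EZ HZ : Type*} [NormedAddCommGroup EZ] [NormedSpace ℝ EZ] [TopologicalSpace HZ]
  {IZ : ModelWithCorners ℝ EZ HZ} {IB : ModelWithCorners ℝ EB HB} {IF : ModelWithCorners ℝ EF HF}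
  {B F Z : Type*} [TopologicalSpace B] [ChartedSpace HB B] [TopologicalSpace F] [ChartedSpace HF F]
  [TopologicalSpace Z] [ChartedSpace HZ Z] {π : Z → B}

namespace IsSmoothTrivialization

variable {e : Bundle.Trivialization F π}

theorem contMDiffAt (he : IsSmoothTrivialization IZ IB IF e) {z : Z} (hz : π z ∈ e.baseSet) :
    ContMDiffAt IZ (IB.prod IF) ∞ e z :=
  he.contMDiffOn_toFun.contMDiffAt (e.open_source.mem_nhds (e.mem_source.2 hz))

theorem contMDiffAt_symm (he : IsSmoothTrivialization IZ IB IF e) {y : B × F}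
    (hy : y.1 ∈ e.baseSet) :
    ContMDiffAt (IB.prod IF) IZ ∞ e.toOpenPartialHomeomorph.symm y :=
  he.contMDiffOn_invFun.contMDiffAt (e.open_target.mem_nhds (e.mem_target.2 hy))

theorem contMDiffAt_snd (he : IsSmoothTrivialization IZ IB IF e) {z : Z} (hz : π z ∈ e.baseSet) :
    ContMDiffAt IZ IF ∞ (fun z => (e z).2) z :=
  _root_.contMDiffAt_snd.comp z (he.contMDiffAt hz)

theorem contMDiffAt_proj (he : IsSmoothTrivialization IZ IB IF e) {z : Z} (hz : π z ∈ e.baseSet) :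
    ContMDiffAt IZ IB ∞ π z := by
  refine (contMDiffAt_fst.comp z (he.contMDiffAt hz)).congr_of_eventuallyEq ?_
  filter_upwards [e.open_source.mem_nhds (e.mem_source.2 hz)] with x hx
  exact (e.coe_fst hx).symm

end IsSmoothTrivialization

theorem IsSmoothFiberBundle.contMDiff_proj (hπ : IsSmoothFiberBundle IZ IB IF F π) :
    ContMDiff IZ IB ∞ π :=
  fun z => (hπ.isSmoothTrivialization (π z)).contMDiffAt_proj (hπ.mem_baseSet _)

end Trivializations

/-! ### The smooth structure of a pull-back bundle -/

section Pullback

variable {EB HB : Type*} [NormedAddCommGroup EB] [NormedSpace ℝ EB] [TopologicalSpace HB]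
  {EF HF : Type*} [NormedAddCommGroup EF] [NormedSpace ℝ EF] [TopologicalSpace HF]
  {EZ HZ : Type*} [NormedAddCommGroup EZ] [NormedSpace ℝ EZ] [TopologicalSpace HZ]
  {IZ : ModelWithCorners ℝ EZ HZ} {IB : ModelWithCorners ℝ EB HB} {IF : ModelWithCorners ℝ EF HF}
  {B F Z : Type*} [TopologicalSpace B] [ChartedSpace HB B] [TopologicalSpace F] [ChartedSpace HF F]
  [TopologicalSpace Z] [ChartedSpace HZ Z] {π : Z → B}
  {EB' HB' : Type*} [NormedAddCommGroup EB'] [NormedSpace ℝ EB'] [TopologicalSpace HB']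
  {IB' : ModelWithCorners ℝ EB' HB'} {B' : Type*} [TopologicalSpace B'] [ChartedSpace HB' B']
  {EN HN : Type*} [NormedAddCommGroup EN] [NormedSpace ℝ EN] [TopologicalSpace HN]
  {IN : ModelWithCorners ℝ EN HN} {N : Type*} [TopologicalSpace N] [ChartedSpace HN N]
  (hπ : IsSmoothFiberBundle IZ IB IF F π) (f : C^∞⟮IB', B'; IB, B⟯)

namespace BundlePullback

/-- The local retraction of `B' × Z` onto `f^* Z` defined by a trivialization of `Z`. -/
def retract (e : Bundle.Trivialization F π) (x : B' × Z) : BundlePullback hπ f :=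
  pullInv hπ f e (x.1, (e x.2).2)

theorem retract_apply {e : Bundle.Trivialization F π} (x : BundlePullback hπ f) (hx : f x.proj ∈ e.baseSet) :
    retract hπ f e (x.proj, x.toTotal) = x :=
  (pullTriv hπ f e).left_inv hx

variable [IsManifold IB' ∞ B'] [IsManifold IF ∞ F]

theorem contMDiff_proj :
    ContMDiff (IB'.prod IF) IB' ∞ (proj : BundlePullback hπ f → B') :=
  (BundlePullback.isSmoothFiberBundle hπ f).contMDiff_proj

/-- In the induced trivialization the map is `(b', v) ↦ e⁻¹(f b', v)`. -/
theorem contMDiff_toTotal :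
    ContMDiff (IB'.prod IF) IZ ∞ (toTotal : BundlePullback hπ f → Z) := by
  intro x
  set e := hπ.triv (f x.proj)
  have hx : f x.proj ∈ e.baseSet := hπ.mem_baseSet _
  have h1 : ContMDiffAt (IB'.prod IF) (IB'.prod IF) ∞ (pullTriv hπ f e) x :=
    ((bundleAtlas hπ f).isSmoothTrivialization x.proj).contMDiffAt (z := x) hx
  have h2 : ContMDiffAt (IB'.prod IF) (IB.prod IF) ∞
      (fun x : BundlePullback hπ f => (f x.proj, (pullTriv hπ f e x).2)) x :=
    (f.contMDiff.comp (contMDiff_proj hπ f) x).prodMk (contMDiffAt_snd.comp x h1)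
  refine (((hπ.isSmoothTrivialization _).contMDiffAt_symm (by exact hx)).comp x
    h2).congr_of_eventuallyEq ?_
  filter_upwards [(continuous_proj hπ f).continuousAt.preimage_mem_nhds
    ((e.open_baseSet.preimage f.contMDiff.continuous).mem_nhds hx)] with x' hx'
  change _ = e.toOpenPartialHomeomorph.symm (f x'.proj, (e x'.toTotal).2)
  rw [x'.condition]
  exact (e.symm_apply_mk_proj (e.mem_source.2 (x'.condition ▸ hx'))).symm

variable {hπ f} in
-- The induced trivialization reads `g` as the projection together with the fibre component of `e`
-- on the total part, so both are smooth. This is the universal property of `f^* Z` inside `B' × Z`.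
theorem contMDiffAt_of_components {g : N → BundlePullback hπ f} {x : N}
    (h1 : ContMDiffAt IN IB' ∞ (fun x => (g x).proj) x)
    (h2 : ContMDiffAt IN IZ ∞ (fun x => (g x).toTotal) x) :
    ContMDiffAt IN (IB'.prod IF) ∞ g x := by
  set e := hπ.triv (f (g x).proj)
  have hx : f (g x).proj ∈ e.baseSet := hπ.mem_baseSet _
  have hx' : π (g x).toTotal ∈ e.baseSet := (g x).condition ▸ hx
  have h3 : ContMDiffAt IN (IB'.prod IF) ∞ (fun y => pullTriv hπ f e (g y)) x :=
    h1.prodMk (ContMDiffAt.comp (g := fun z => (e z).2) x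
      ((hπ.isSmoothTrivialization _).contMDiffAt_snd hx') h2)
  refine ((((bundleAtlas hπ f).isSmoothTrivialization (g x).proj).contMDiffAt_symm
    (y := pullTriv hπ f e (g x)) hx).comp x h3).congr_of_eventuallyEq ?_
  filter_upwards [h1.continuousAt.preimage_mem_nhds
    ((e.open_baseSet.preimage f.contMDiff.continuous).mem_nhds hx)] with y hy
  exact ((pullTriv hπ f e).left_inv hy).symm

/-- The atlas of `f^* Z` is built only from the chosen trivializations `hπ.triv`. The equivariant
trivializations of a principal bundle need not be among them, so an arbitrary smooth `e` has to be
allowed. -/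
theorem isSmoothTrivialization_pullTriv {e : Bundle.Trivialization F π}
    (he : IsSmoothTrivialization IZ IB IF e) :
    IsSmoothTrivialization (IB'.prod IF) IB' IF (pullTriv hπ f e) := by
  constructor
  · intro x hx
    have hx' : f x.proj ∈ e.baseSet := hx
    exact ((contMDiff_proj hπ f x).prodMk ((he.contMDiffAt_snd
      (by rwa [← x.condition])).comp x (contMDiff_toTotal hπ f x))).contMDiffWithinAt
  · intro y hy
    have hy' : f y.1 ∈ e.baseSet := hy.1
    have h : ContMDiffAt (IB'.prod IF) (IB.prod IF) ∞ (fun y : B' × F => (f y.1, y.2)) y :=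
      ((f.contMDiff.comp contMDiff_fst).prodMk contMDiff_snd) y
    refine (contMDiffAt_of_components contMDiffAt_fst
      (((he.contMDiffAt_symm (by exact hy')).comp y h).congr_of_eventuallyEq ?_)).contMDiffWithinAt
    filter_upwards [(pullTriv hπ f e).open_target.mem_nhds hy] with y' hy'
    exact toTotal_pullInv hπ f e hy'.1

variable {e : Bundle.Trivialization F π}

theorem contMDiffAt_retract (he : IsSmoothTrivialization IZ IB IF e) {x : B' × Z}
    (h1 : f x.1 ∈ e.baseSet) (h2 : π x.2 ∈ e.baseSet) :
    ContMDiffAt (IB'.prod IZ) (IB'.prod IF) ∞ (retract hπ f e) x :=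
  ((isSmoothTrivialization_pullTriv hπ f he).contMDiffAt_symm (by exact h1)).comp x
    (contMDiffAt_fst.prodMk ((he.contMDiffAt_snd h2).comp x contMDiffAt_snd))

end BundlePullback

end Pullback

/-! ### Existence and uniqueness of the pull-back connection -/

section PullbackConnection

variable {EB HB : Type*} [NormedAddCommGroup EB] [NormedSpace ℝ EB] [TopologicalSpace HB]
  {EF HF : Type*} [NormedAddCommGroup EF] [NormedSpace ℝ EF] [TopologicalSpace HF]
  {EZ HZ : Type*} [NormedAddCommGroup EZ] [NormedSpace ℝ EZ] [TopologicalSpace HZ]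
  {IZ : ModelWithCorners ℝ EZ HZ} {IB : ModelWithCorners ℝ EB HB} {IF : ModelWithCorners ℝ EF HF}
  {B F Z : Type*} [TopologicalSpace B] [ChartedSpace HB B] [TopologicalSpace F] [ChartedSpace HF F]
  [TopologicalSpace Z] [ChartedSpace HZ Z] {π : Z → B}
  {EB' HB' : Type*} [NormedAddCommGroup EB'] [NormedSpace ℝ EB'] [TopologicalSpace HB']
  {IB' : ModelWithCorners ℝ EB' HB'} {B' : Type*} [TopologicalSpace B'] [ChartedSpace HB' B']
  [IsManifold IB' ∞ B'] [IsManifold IF ∞ F]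
  (hπ : IsSmoothFiberBundle IZ IB IF F π) (f : C^∞⟮IB', B'; IB, B⟯)

namespace BundlePullback

/-- A tangent vector of `f^* Z` is determined by its images in the tangent spaces of `B'`
and `Z`. -/
theorem tangent_ext {x : BundlePullback hπ f} {w w' : EB' × EF}
    (h1 : (mfderiv (IB'.prod IF) IB' proj x w : EB') = mfderiv (IB'.prod IF) IB' proj x w')
    (h2 : (mfderiv (IB'.prod IF) IZ toTotal x w : EZ) = mfderiv (IB'.prod IF) IZ toTotal x w') :
    w = w' := by
  set e := hπ.triv (f x.proj)
  have hx : f x.proj ∈ e.baseSet := hπ.mem_baseSet _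
  have hp := (contMDiff_proj hπ f x).mdifferentiableAt (by simp)
  have ht := (contMDiff_toTotal hπ f x).mdifferentiableAt (by simp)
  -- The retraction is a left inverse of the inclusion into `B' × Z` near `x`, so `key` recovers a
  -- vector from its image in the product.
  have key := mfderiv_apply_of_eventuallyEq_id (I := IB'.prod IF) (I' := IB'.prod IZ) (x := x)
    (f := fun x : BundlePullback hπ f => (x.proj, x.toTotal)) (g := retract hπ f e) rfl
    (by filter_upwards [(continuous_proj hπ f).continuousAt.preimage_mem_nhds
          ((e.open_baseSet.preimage f.contMDiff.continuous).mem_nhds hx)] with x' hx'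
        exact retract_apply hπ f x' hx')
    ((contMDiffAt_retract hπ f (hπ.isSmoothTrivialization _) hx
      (by rwa [← x.condition])).mdifferentiableAt (by simp)) (hp.prodMk ht)
  rw [← key w, ← key w', mfderiv_prodMk_apply hp ht, mfderiv_prodMk_apply hp ht, h1, h2]

/-- The horizontal lift of the pull-back connection, in terms of a trivialization of `Z`. -/
def liftAux (e : Bundle.Trivialization F π) (L : Z → EB →L[ℝ] EZ) (x : BundlePullback hπ f) :
    EB' →L[ℝ] EB' × EF :=
  (mfderiv IB' (IB'.prod IF) (fun b => retract hπ f e (b, x.toTotal)) x.proj : EB' →L[ℝ] EB' × EF) +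
    ((mfderiv IZ (IB'.prod IF) (fun z => retract hπ f e (x.proj, z)) x.toTotal :
      EZ →L[ℝ] EB' × EF).comp
      ((L x.toTotal).comp (mfderiv IB' IB f x.proj : EB' →L[ℝ] EB)))

section

variable {e : Bundle.Trivialization F π} {L : Z → EB →L[ℝ] EZ}

/-- The partial derivatives add up to the total one. The total form serves to compute projections;
the partial form of the definition serves smoothness, because the derivative of a smooth family in
one variable is smooth in the parameter. -/
theorem liftAux_apply (he : IsSmoothTrivialization IZ IB IF e) (x : BundlePullback hπ f)
    (hx : f x.proj ∈ e.baseSet) (u : EB') :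
    liftAux hπ f e L x u = mfderiv (IB'.prod IZ) (IB'.prod IF) (retract hπ f e)
      (x.proj, x.toTotal) (u, L x.toTotal (mfderiv IB' IB f x.proj u : EB)) :=
  (mfderiv_prod_eq_add_apply (f := retract hπ f e) (p := (x.proj, x.toTotal))
    (v := ((u, L x.toTotal (mfderiv IB' IB f x.proj u : EB)) : EB' × EZ))
    ((contMDiffAt_retract hπ f he hx (by rwa [← x.condition])).mdifferentiableAt (by simp))).symm

theorem mfderiv_proj_liftAux (he : IsSmoothTrivialization IZ IB IF e) (x : BundlePullback hπ f)
    (hx : f x.proj ∈ e.baseSet) (u : EB') :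
    (mfderiv (IB'.prod IF) IB' proj x (liftAux hπ f e L x u) : EB') = u := by
  rw [liftAux_apply hπ f he x hx]
  rw [← mfderiv_apply_of_eventuallyEq_comp (I'' := IB') (F := Prod.fst) (g := proj)
    (retract_apply hπ f x hx) (Filter.Eventually.of_forall fun _ => rfl)
    ((contMDiff_proj hπ f x).mdifferentiableAt (by simp))
    ((contMDiffAt_retract hπ f he hx (by rwa [← x.condition])).mdifferentiableAt (by simp)),
    mfderiv_fst]
  rfl

/-- The total part of the retraction is `e⁻¹(f b', pr₂ (e z))`. Its derivative keeps the fibre part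
of the lift `w` and replaces the base part by `Tf u`. As `L` splits `Tπ`, the base part of `w`
already is `Tf u`, and the result is `w`. -/
theorem mfderiv_toTotal_liftAux (hL : ∀ z u, (mfderiv IZ IB π z (L z u : EZ) : EB) = u)
    (he : IsSmoothTrivialization IZ IB IF e) (x : BundlePullback hπ f)
    (hx : f x.proj ∈ e.baseSet) (u : EB') :
    (mfderiv (IB'.prod IF) IZ toTotal x (liftAux hπ f e L x u) : EZ) =
      L x.toTotal (mfderiv IB' IB f x.proj u : EB) := by
  have hx' : π x.toTotal ∈ e.baseSet := by rwa [← x.condition]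
  have hef : MDifferentiableAt IZ IF (fun z => (e z).2) x.toTotal :=
    (he.contMDiffAt_snd hx').mdifferentiableAt (by simp)
  have hf : MDifferentiableAt IB' IB f x.proj := (f.contMDiff _).mdifferentiableAt (by simp)
  have hes := (he.contMDiffAt_symm (y := (f x.proj, (e x.toTotal).2)) hx).mdifferentiableAt
    (n := ∞) (by simp)
  have hf' : MDifferentiableAt (IB'.prod IZ) IB (fun y : B' × Z => f y.1) (x.proj, x.toTotal) :=
    MDifferentiableAt.comp (x.proj, x.toTotal) (g := f) hf mdifferentiableAt_fst
  have hef' : MDifferentiableAt (IB'.prod IZ) IF (fun y : B' × Z => (e y.2).2)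
      (x.proj, x.toTotal) :=
    MDifferentiableAt.comp (x.proj, x.toTotal) (g := fun z => (e z).2) hef mdifferentiableAt_snd
  rw [liftAux_apply hπ f he x hx]
  set w : EZ := L x.toTotal (mfderiv IB' IB f x.proj u : EB)
  have hev : ∀ᶠ z in 𝓝 x.toTotal, z ∈ e.source :=
    e.open_source.mem_nhds (e.mem_source.2 hx')
  -- The explicit formula for the total part is valid only where `f b'` lies in the base set of `e`;
  -- elsewhere `pullInv` takes its default value.
  refine (mfderiv_apply_of_eventuallyEq_comp (I'' := IZ) (g := toTotal)
    (F := fun y : B' × Z => e.toOpenPartialHomeomorph.symm (f y.1, (e y.2).2))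
    (retract_apply hπ f x hx) ?_
    ((contMDiff_toTotal hπ f x).mdifferentiableAt (by simp))
    ((contMDiffAt_retract hπ f he hx hx').mdifferentiableAt (by simp)) (u, w)).symm.trans ?_
  · have : ∀ᶠ y : B' × Z in 𝓝 (x.proj, x.toTotal), f y.1 ∈ e.baseSet :=
      (f.contMDiff.continuous.comp continuous_fst).continuousAt.preimage_mem_nhds
        (e.open_baseSet.mem_nhds hx)
    filter_upwards [this] with y hy
    exact (toTotal_pullInv hπ f e (y := (y.1, (e y.2).2)) hy).symm
  refine (mfderiv_apply_of_eventuallyEq_comp (I' := IB.prod IF)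
    (g := e.toOpenPartialHomeomorph.symm) (f := fun y : B' × Z => (f y.1, (e y.2).2)) rfl
    (Filter.Eventually.of_forall fun _ => rfl) hes (hf'.prodMk hef') (u, w)).trans ?_
  rw [mfderiv_prodMk_apply hf' hef',
    mfderiv_apply_of_eventuallyEq_comp (F := fun y : B' × Z => f y.1) (I' := IB') (g := f)
      (f := Prod.fst) rfl (Filter.Eventually.of_forall fun _ => rfl) hf mdifferentiableAt_fst,
    mfderiv_apply_of_eventuallyEq_comp (F := fun y : B' × Z => (e y.2).2) (I' := IZ)
      (g := fun z => (e z).2) (f := Prod.snd) rfl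
      (Filter.Eventually.of_forall fun _ => rfl) hef mdifferentiableAt_snd,
    mfderiv_fst, mfderiv_snd]
  have hπd : MDifferentiableAt IZ IB π x.toTotal :=
    (he.contMDiffAt_proj hx').mdifferentiableAt (by simp)
  -- Decomposition of `w` itself through `e`: the inverse trivialization undoes `(π, pr₂ ∘ e)`.
  have h2 := mfderiv_apply_of_eventuallyEq_id (I := IZ) (I' := IB.prod IF) (x := x.toTotal)
    (y := (f x.proj, (e x.toTotal).2)) (f := fun z => (π z, (e z).2))
    (g := e.toOpenPartialHomeomorph.symm) (Prod.ext x.condition.symm rfl)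
    (by filter_upwards [hev] with z hz
        exact e.symm_apply_mk_proj hz) hes (hπd.prodMk hef) w
  have hLw : (mfderiv IZ IB π x.toTotal w : EB) = mfderiv IB' IB f x.proj u := hL _ _
  rw [mfderiv_prodMk_apply hπd hef, hLw] at h2
  exact h2

end

variable [IsManifold IZ ∞ Z] [IsManifold IB ∞ B]

/-- The three tangent maps are derivatives of smooth families in one variable, and the lift of `Γ`
is smooth along `toTotal`. Composition and addition in tangent coordinates preserve smoothness. -/
theorem contMDiffAt_liftAux (Γ : Connection IZ IB π) {e : Bundle.Trivialization F π}
    (he : IsSmoothTrivialization IZ IB IF e) (x₀ : BundlePullback hπ f)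
    (hx : f x₀.proj ∈ e.baseSet) :
    ContMDiffAt (IB'.prod IF) 𝓘(ℝ, EB' →L[ℝ] EB' × EF) ∞
      (inTangentCoordinates IB' (IB'.prod IF) proj _root_.id
        (liftAux hπ f e fun z => (Γ.lift z : EB →L[ℝ] EZ)) x₀) x₀ := by
  have hx' : π x₀.toTotal ∈ e.baseSet := by rwa [← x₀.condition]
  have hr : (fun x : BundlePullback hπ f => retract hπ f e (x.proj, x.toTotal)) =ᶠ[𝓝 x₀] id := by
    filter_upwards [(continuous_proj hπ f).continuousAt.preimage_mem_nhds
      ((e.open_baseSet.preimage f.contMDiff.continuous).mem_nhds hx)] with x' hx'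
    exact retract_apply hπ f x' hx'
  have hret := contMDiffAt_retract hπ f (x := (x₀.proj, x₀.toTotal)) he hx hx'
  have h1 := ContMDiffAt.mfderiv (x₀ := x₀) (I := IB') (I' := IB'.prod IF) (J := IB'.prod IF)
    (m := ∞) (n := ∞) (fun (x : BundlePullback hπ f) b => retract hπ f e (b, x.toTotal)) proj
    (hret.comp (x₀, x₀.proj)
      (contMDiffAt_snd.prodMk ((contMDiff_toTotal hπ f _).comp (x₀, x₀.proj) contMDiffAt_fst)))
    (contMDiff_proj hπ f x₀) (by simp)
  have h2 := ContMDiffAt.mfderiv (x₀ := x₀) (I := IZ) (I' := IB'.prod IF) (J := IB'.prod IF)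
    (m := ∞) (n := ∞) (fun (x : BundlePullback hπ f) z => retract hπ f e (x.proj, z)) toTotal
    (hret.comp (x₀, x₀.toTotal)
      (((contMDiff_proj hπ f _).comp (x₀, x₀.toTotal) contMDiffAt_fst).prodMk contMDiffAt_snd))
    (contMDiff_toTotal hπ f x₀) (by simp)
  have h3 := ContMDiffAt.mfderiv (x₀ := x₀) (I := IB') (I' := IB) (J := IB'.prod IF)
    (m := ∞) (n := ∞) (fun (_ : BundlePullback hπ f) b => f b) proj
    ((f.contMDiff _).comp (x₀, x₀.proj) contMDiffAt_snd)
    (contMDiff_proj hπ f x₀) (by simp)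
  have h4 : ContMDiffAt (IB'.prod IF) 𝓘(ℝ, EB →L[ℝ] EZ) ∞
      (inTangentCoordinates IB IZ (fun x : BundlePullback hπ f => f x.proj) toTotal
        (fun x => (Γ.lift x.toTotal : EB →L[ℝ] EZ)) x₀) x₀ := by
    have := (Γ.smooth_lift x₀.toTotal).comp x₀ (contMDiff_toTotal hπ f x₀)
    -- The lift of `Γ` starts at `π x.toTotal`, whereas the derivative of `f` ends at `f x.proj`;
    -- the defining condition of the pull-back identifies the two.
    have hc : (fun x : BundlePullback hπ f => f x.proj) = fun x => π x.toTotal :=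
      funext fun x => x.condition
    rw [hc]
    exact this
  have h34 := (h4.clm_comp h3).congr_of_eventuallyEq
    (inTangentCoordinates_comp _ _ ((f.contMDiff.continuous.comp (continuous_proj hπ f)).continuousAt))
  have h234 := (h2.clm_comp h34).congr_of_eventuallyEq
    (inTangentCoordinates_comp _ _ (continuous_toTotal hπ f).continuousAt)
  refine ((h1.congr_of_eventuallyEq ?_).add (h234.congr_of_eventuallyEq ?_)).congr_of_eventuallyEq
    (Filter.Eventually.of_forall fun x => inTangentCoordinates_add _ _ _ _)
  -- The partial derivatives end at the retracted point, which is `x` itself only near `x₀`.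
  · exact inTangentCoordinates_congr (Filter.EventuallyEq.refl _ _) hr.symm
      (Filter.EventuallyEq.refl _ _)
  · exact inTangentCoordinates_congr (Filter.EventuallyEq.refl _ _) hr.symm
      (Filter.EventuallyEq.refl _ _)

/-- The pull-back of a connection. -/
def connection (Γ : Connection IZ IB π) :
    Connection (IB'.prod IF) IB' (proj : BundlePullback hπ f → B') where
  lift x := (liftAux hπ f (hπ.triv (f x.proj)) (fun z => (Γ.lift z : EB →L[ℝ] EZ)) x :)
  mfderiv_lift x u := mfderiv_proj_liftAux hπ f (hπ.isSmoothTrivialization _) x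
    (hπ.mem_baseSet _) u
  smooth_lift x₀ := by
    -- The trivialization used at `x` varies with `x` without any continuity. Near `x₀` it may be
    -- replaced by the one fixed at `x₀`, since the lift is characterized by its two images.
    refine (contMDiffAt_liftAux hπ f Γ (hπ.isSmoothTrivialization _) x₀
      (hπ.mem_baseSet (f x₀.proj))).congr_of_eventuallyEq
      (inTangentCoordinates_congr (Filter.EventuallyEq.refl _ _) (Filter.EventuallyEq.refl _ _) ?_)
    filter_upwards [(continuous_proj hπ f).continuousAt.preimage_mem_nhds
      (((hπ.triv (f x₀.proj)).open_baseSet.preimage f.contMDiff.continuous).mem_nhds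
        (hπ.mem_baseSet (f x₀.proj)))] with x hx
    ext1 u
    refine tangent_ext hπ f (x := x) ?_ ?_
    · exact (mfderiv_proj_liftAux hπ f (hπ.isSmoothTrivialization _) x (hπ.mem_baseSet _) u).trans
        (mfderiv_proj_liftAux hπ f (hπ.isSmoothTrivialization _) x hx u).symm
    · exact (mfderiv_toTotal_liftAux hπ f Γ.mfderiv_lift (hπ.isSmoothTrivialization _) x
        (hπ.mem_baseSet _) u).trans
        (mfderiv_toTotal_liftAux hπ f Γ.mfderiv_lift (hπ.isSmoothTrivialization _) x hx u).symm

/-- The splitting property prescribes the image of a lift in `TB'`, and the pull-back condition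
prescribes its image in `TZ`; nothing remains free. -/
theorem existsUnique_isPullback (Γ : Connection IZ IB π) :
    ∃! Γ' : Connection (IB'.prod IF) IB' (proj : BundlePullback hπ f → B'),
      Γ'.IsPullback toTotal f Γ := by
  refine ⟨connection hπ f Γ, fun x u => mfderiv_toTotal_liftAux hπ f Γ.mfderiv_lift
    (hπ.isSmoothTrivialization _) x (hπ.mem_baseSet _) u, fun Γ' h => ?_⟩
  refine Connection.ext (funext fun x => ContinuousLinearMap.ext fun u => ?_)
  refine tangent_ext hπ f (x := x) ?_ ?_
  · exact (Γ'.mfderiv_lift x u).trans ((connection hπ f Γ).mfderiv_lift x u).symm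
  · exact (h x u).trans (mfderiv_toTotal_liftAux hπ f Γ.mfderiv_lift
      (hπ.isSmoothTrivialization _) x (hπ.mem_baseSet _) u).symm

end BundlePullback

end PullbackConnection

/-! ### Vertical vectors on principal bundles -/

section Principal

variable {EP HP : Type*} [NormedAddCommGroup EP] [NormedSpace ℝ EP] [TopologicalSpace HP]
  {EB HB : Type*} [NormedAddCommGroup EB] [NormedSpace ℝ EB] [TopologicalSpace HB]
  {EK HK : Type*} [NormedAddCommGroup EK] [NormedSpace ℝ EK] [TopologicalSpace HK]
  {EV HV : Type*} [NormedAddCommGroup EV] [NormedSpace ℝ EV] [TopologicalSpace HV]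
  {IP : ModelWithCorners ℝ EP HP} {IB : ModelWithCorners ℝ EB HB}
  {IK : ModelWithCorners ℝ EK HK} {IV : ModelWithCorners ℝ EV HV}
  {P : Type*} [TopologicalSpace P] [ChartedSpace HP P]
  {B : Type*} [TopologicalSpace B] [ChartedSpace HB B]
  {K : Type*} [TopologicalSpace K] [ChartedSpace HK K] [Group K]
  {V : Type*} [TopologicalSpace V] [ChartedSpace HV V] [MulAction K V]
  {act : P → K → P} {π : P → B}

namespace IsPrincipalBundle

variable (hq : IsPrincipalBundle IP IB IK act π)

/-- Equivariance gives both sides the same fibre coordinate `g`. A fibre of the trivialization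
thereby becomes an orbit map, whose derivative at `1` produces vertical vectors. -/
theorem triv_symm_eq (b : B) {p : P} (hp : π p ∈ (hq.triv b).baseSet) (g : K) :
    (hq.triv b).toOpenPartialHomeomorph.symm (π p, g) = act p ((hq.triv b p).2⁻¹ * g) := by
  set e := hq.triv b
  have hp' : p ∈ e.source := e.mem_source.2 hp
  have h' : π (act p ((e p).2⁻¹ * g)) = π p := hq.proj_act _ _
  have hs : act p ((e p).2⁻¹ * g) ∈ e.source := e.mem_source.2 (h' ▸ hp)
  rw [← e.symm_apply_mk_proj hs, h', hq.triv_act b hp', mul_inv_cancel_left]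

theorem contMDiff_act_right (hq : IsPrincipalBundle IP IB IK act π) (g : K) : ContMDiff IP IP ∞ (fun p => act p g) :=
  hq.contMDiff_act.comp (contMDiff_id.prodMk contMDiff_const)

theorem contMDiff_act_left (hq : IsPrincipalBundle IP IB IK act π) (p : P) :
    ContMDiff IK IP ∞ (fun g => act p g) :=
  hq.contMDiff_act.comp (contMDiff_const.prodMk contMDiff_id)

/-- Tangent vectors of a principal bundle along the fibres come from the Lie algebra. -/
theorem exists_verticalVector_eq [ContMDiffMul IK ∞ K]
    (hq : IsPrincipalBundle IP IB IK act π) (p : P) (w : EP)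
    (hw : (mfderiv IP IB π p w : EB) = 0) :
    ∃ ξ : GroupLieAlgebra IK K, verticalVector IP IK act p ξ = w := by
  set e := hq.triv (π p)
  have he := hq.isSmoothTrivialization (π p)
  have hp : π p ∈ e.baseSet := hq.mem_baseSet _
  have hp' : p ∈ e.source := e.mem_source.2 hp
  have h2 : MDifferentiableAt IP IK (fun x => (e x).2) p :=
    (he.contMDiffAt_snd hp).mdifferentiableAt (by simp)
  have h3 : MDifferentiableAt IP IK (fun x => (e p).2⁻¹ * (e x).2) p :=
    (contMDiffAt_const.mul (he.contMDiffAt_snd hp)).mdifferentiableAt (n := ∞) (by simp)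
  have hes : MDifferentiableAt (IB.prod IK) IP e.toOpenPartialHomeomorph.symm (π p, (e p).2) :=
    (he.contMDiffAt_symm (by exact hp)).mdifferentiableAt (by simp)
  have hπ : MDifferentiableAt IP IB π p := (hq.contMDiff_proj p).mdifferentiableAt (by simp)
  -- Left translation by `(e p).2⁻¹` moves the fibre coordinate of `p` to `1`, so the image of `w`
  -- lands in the Lie algebra.
  refine ⟨(mfderiv IP IK (fun x => (e p).2⁻¹ * (e x).2) p w : EK), ?_⟩
  -- The map `x ↦ e⁻¹(π p, pr₂ (e x))` pushes everything into the fibre of `p`. Its derivative is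
  -- computed through the orbit map in `k1` and through `e` in `k2`; `k3` decomposes `w`, whose base
  -- component vanishes, so that all three agree.
  have k1 := mfderiv_apply_of_eventuallyEq_comp (I := IP) (I' := IK) (I'' := IP) (x := p) (y := 1)
    (F := fun x => e.toOpenPartialHomeomorph.symm (π p, (e x).2)) (g := fun g : K => act p g)
    (f := fun x => (e p).2⁻¹ * (e x).2) (inv_mul_cancel _)
    (Filter.Eventually.of_forall fun x => hq.triv_symm_eq (π p) hp _)
    ((hq.contMDiff_act_left p _).mdifferentiableAt (by simp)) h3 w
  have k2 := mfderiv_apply_of_eventuallyEq_comp (I := IP) (I' := IB.prod IK) (I'' := IP) (x := p)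
    (F := fun x => e.toOpenPartialHomeomorph.symm (π p, (e x).2))
    (g := e.toOpenPartialHomeomorph.symm) (f := fun x => (π p, (e x).2)) rfl
    (Filter.Eventually.of_forall fun x => rfl) hes (mdifferentiableAt_const.prodMk h2) w
  have k3 := mfderiv_apply_of_eventuallyEq_id (I := IP) (I' := IB.prod IK) (x := p)
    (f := fun z => (π z, (e z).2)) (g := e.toOpenPartialHomeomorph.symm) rfl
    (by filter_upwards [e.open_source.mem_nhds hp'] with z hz
        exact e.symm_apply_mk_proj hz) hes (hπ.prodMk h2) w
  rw [mfderiv_prodMk_apply hπ h2, hw] at k3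
  rw [mfderiv_prodMk_apply mdifferentiableAt_const h2, mfderiv_const] at k2
  exact k1.symm.trans (k2.trans k3)

end IsPrincipalBundle

/-! ### Local sections and smoothness of the quotient map onto an associated bundle -/

namespace AssocBundle

variable (hq : IsPrincipalBundle IP IB IK act π)

theorem mk_eq_mk_iff {x y : P × V} :
    mk IV V hq x = mk IV V hq y ↔ ∃ g : K, y = (act x.1 g, g⁻¹ • x.2) :=
  Quotient.eq (r := hq.assocSetoid V)

variable (IV)

/-- A local section of `P × V → (P × V) / K` defined by a trivialization at `b` and an element `g`
of the structure group. -/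
def localSection (b : B) (g : K) (y : AssocBundle IV hq V) : P × V :=
  ((hq.triv b).toOpenPartialHomeomorph.symm (proj IV V hq y, g), g⁻¹ • (trivFun IV hq b y).2)

theorem mk_localSection (b : B) (g : K) {y : AssocBundle IV hq V}
    (hy : proj IV V hq y ∈ (hq.triv b).baseSet) :
    mk IV V hq (localSection IV hq b g y) = y := by
  obtain ⟨⟨p, v⟩, rfl⟩ := Quotient.exists_rep y
  have hp : π p ∈ (hq.triv b).baseSet := hy
  change mk IV V hq (localSection IV hq b g (mk IV V hq (p, v))) = mk IV V hq (p, v)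
  rw [localSection, trivFun_mk IV hq b hp]
  change mk IV V hq ((hq.triv b).toOpenPartialHomeomorph.symm (π p, g), _) = _
  rw [hq.triv_symm_eq b hp, ← mk_act IV hq p v ((hq.triv b p).2⁻¹ * g)]
  simp [mul_smul]

/-- The parameter `g` selects the representative along the orbit. This value makes the section pass
through the prescribed pair, as is needed to show that the quotient map is a submersion at every
point. -/
theorem localSection_mk (b : B) {p : P} (hp : π p ∈ (hq.triv b).baseSet) (v : V) :
    localSection IV hq b (hq.triv b p).2 (mk IV V hq (p, v)) = (p, v) := by
  rw [localSection, trivFun_mk IV hq b hp]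
  exact Prod.ext ((hq.triv b).symm_apply_mk_proj ((hq.triv b).mem_source.2 hp)) (inv_smul_smul _ _)

variable [ContMDiffSMul IK IV ∞ K V] [IsManifold IB ∞ B] [IsManifold IV ∞ V]

theorem contMDiff_proj : ContMDiff (IB.prod IV) IB ∞ (proj IV V hq) :=
  (AssocBundle.isSmoothFiberBundle IV hq).contMDiff_proj

theorem contMDiffAt_trivFun (b : B) {y : AssocBundle IV hq V}
    (hy : proj IV V hq y ∈ (hq.triv b).baseSet) :
    ContMDiffAt (IB.prod IV) (IB.prod IV) ∞ (trivFun IV hq b) y :=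
  ((bundleAtlas IV hq).isSmoothTrivialization b).contMDiffAt (z := y) hy

theorem contMDiffAt_localSection (b : B) (g : K) {y : AssocBundle IV hq V}
    (hy : proj IV V hq y ∈ (hq.triv b).baseSet) :
    ContMDiffAt (IB.prod IV) (IP.prod IV) ∞ (localSection IV hq b g) y := by
  refine ContMDiffAt.prodMk ?_ ?_
  · exact ((hq.isSmoothTrivialization b).contMDiffAt_symm (y := (proj IV V hq y, g)) hy).comp y
      ((contMDiff_proj IV hq y).prodMk contMDiffAt_const)
  · exact (ContMDiffSMul.contMDiff_smul (I := IK) (I' := IV) (n := ∞) (G := K) (M := V) _).comp y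
      (contMDiffAt_const.prodMk (contMDiffAt_snd.comp y (contMDiffAt_trivFun IV hq b hy)))

/-- In the trivializations induced by `e` the map is `(p, v) ↦ (π p, pr₂ (e p) • v)`. -/
theorem contMDiff_mk : ContMDiff (IP.prod IV) (IB.prod IV) ∞ (mk IV V hq) := by
  rintro ⟨p, v⟩
  set e := hq.triv (π p)
  have hp : π p ∈ e.baseSet := hq.mem_baseSet _
  have h1 : ContMDiffAt (IP.prod IV) (IB.prod IV) ∞
      (fun x : P × V => (π x.1, (e x.1).2 • x.2)) (p, v) :=
    ((hq.contMDiff_proj _).comp (p, v) contMDiffAt_fst).prodMk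
      ((ContMDiffSMul.contMDiff_smul (I := IK) (I' := IV) (n := ∞) (G := K) (M := V) _).comp (p, v)
        ((ContMDiffAt.comp (g := fun x => (e x).2) (p, v)
          ((hq.isSmoothTrivialization _).contMDiffAt_snd hp) contMDiffAt_fst).prodMk contMDiffAt_snd))
  refine ((((bundleAtlas IV hq).isSmoothTrivialization (π p)).contMDiffAt_symm
    (y := (π p, (e p).2 • v)) hp).comp (p, v) h1).congr_of_eventuallyEq ?_
  filter_upwards [(hq.contMDiff_proj.continuous.comp continuous_fst).continuousAt.preimage_mem_nhds
    (e.open_baseSet.mem_nhds hp)] with x hx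
  have h2 := (assocTriv IV hq (π p)).left_inv (x := mk IV V hq x) hx
  refine h2.symm.trans ?_
  change (assocTriv IV hq (π p)).toOpenPartialHomeomorph.symm
    (trivFun IV hq (π p) (mk IV V hq x)) = _
  rw [trivFun_mk IV hq (π p) hx]
  rfl

theorem contMDiff_mk_left (v : V) : ContMDiff IP (IB.prod IV) ∞ (fun p => mk IV V hq (p, v)) :=
  (contMDiff_mk IV hq).comp (contMDiff_id.prodMk contMDiff_const)

theorem contMDiff_mk_right (p : P) : ContMDiff IV (IB.prod IV) ∞ (fun v => mk IV V hq (p, v)) :=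
  (contMDiff_mk IV hq).comp (contMDiff_const.prodMk contMDiff_id)

/-- The tangent map of `P → (P × V) / K` sends vertical vectors to the values of the vector fields
generating the action on the fibres. -/
theorem mfderiv_mk_verticalVector (p : P) (v : V) (ξ : GroupLieAlgebra IK K) :
    (mfderiv IP (IB.prod IV) (fun p => mk IV V hq (p, v)) p (verticalVector IP IK act p ξ) :
      EB × EV) =
    mfderiv IV (IB.prod IV) (fun v => mk IV V hq (p, v)) v (generator IK IV v ξ : EV) := by
  -- The map `g ↦ [pg, v] = [p, gv]` is differentiated at `1` twice, through `P` in `h1` and through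
  -- `V` in `h2`.
  have h1 := mfderiv_apply_of_eventuallyEq_comp (I := IK) (I' := IP) (I'' := IB.prod IV) (x := 1)
    (y := p) (F := fun g : K => mk IV V hq (act p g, v)) (g := fun p => mk IV V hq (p, v))
    (f := fun g => act p g) (hq.act_one p) (Filter.Eventually.of_forall fun _ => rfl)
    ((contMDiff_mk_left IV hq v p).mdifferentiableAt (by simp))
    ((hq.contMDiff_act_left p _).mdifferentiableAt (by simp)) ξ
  have hs : ContMDiff IK IV ∞ (fun g : K => g • v) :=
    (ContMDiffSMul.contMDiff_smul (I := IK) (I' := IV) (n := ∞) (G := K) (M := V)).comp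
      (contMDiff_id.prodMk contMDiff_const)
  have h2 := mfderiv_apply_of_eventuallyEq_comp (I := IK) (I' := IV) (I'' := IB.prod IV) (x := 1)
    (y := v) (F := fun g : K => mk IV V hq (act p g, v)) (g := fun v => mk IV V hq (p, v))
    (f := fun g => g • v) (one_smul _ v) (Filter.Eventually.of_forall fun g => by
      have := mk_act IV hq p (g • v) g
      rwa [inv_smul_smul] at this)
    ((contMDiff_mk_right IV hq p v).mdifferentiableAt (by simp))
    ((hs 1).mdifferentiableAt (by simp)) ξ
  exact h1.symm.trans h2

end AssocBundle

end Principal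

/-! ### Pull-backs of principal and associated bundles -/

section Principal

variable {EP HP : Type*} [NormedAddCommGroup EP] [NormedSpace ℝ EP] [TopologicalSpace HP]
  {EB HB : Type*} [NormedAddCommGroup EB] [NormedSpace ℝ EB] [TopologicalSpace HB]
  {EK HK : Type*} [NormedAddCommGroup EK] [NormedSpace ℝ EK] [TopologicalSpace HK]
  {EV HV : Type*} [NormedAddCommGroup EV] [NormedSpace ℝ EV] [TopologicalSpace HV]
  {IP : ModelWithCorners ℝ EP HP} {IB : ModelWithCorners ℝ EB HB}
  {IK : ModelWithCorners ℝ EK HK} {IV : ModelWithCorners ℝ EV HV}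
  {P : Type*} [TopologicalSpace P] [ChartedSpace HP P]
  {B : Type*} [TopologicalSpace B] [ChartedSpace HB B]
  {K : Type*} [TopologicalSpace K] [ChartedSpace HK K] [Group K]
  {V : Type*} [TopologicalSpace V] [ChartedSpace HV V] [MulAction K V]
  {act : P → K → P} {π : P → B}

variable {EB' HB' : Type*} [NormedAddCommGroup EB'] [NormedSpace ℝ EB'] [TopologicalSpace HB']
  {IB' : ModelWithCorners ℝ EB' HB'} {B' : Type*} [TopologicalSpace B'] [ChartedSpace HB' B']
  [IsManifold IB' ∞ B']
  (hq : IsPrincipalBundle IP IB IK act π) (f : C^∞⟮IB', B'; IB, B⟯)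

namespace PrincipalPullback

theorem contMDiff_rightAct [LieGroup IK ∞ K] :
    ContMDiff ((IB'.prod IK).prod IK) (IB'.prod IK) ∞
      (fun x : PrincipalPullback hq f × K => rightAct hq f x.1 x.2) := fun x =>
  BundlePullback.contMDiffAt_of_components
    (ContMDiffAt.comp (g := BundlePullback.proj) (f := fun z => z.1) x
      (BundlePullback.contMDiff_proj hq.isSmoothFiberBundle f _) contMDiffAt_fst)
    ((hq.contMDiff_act _).comp x
      ((ContMDiffAt.comp (g := BundlePullback.toTotal) (f := fun z => z.1) x
        (BundlePullback.contMDiff_toTotal hq.isSmoothFiberBundle f _) contMDiffAt_fst).prodMk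
          contMDiffAt_snd))

/-- The pull-back of a principal bundle is a principal bundle. -/
theorem isPrincipalBundle [LieGroup IK ∞ K] :
    IsPrincipalBundle (IB'.prod IK) IB' IK (rightAct hq f)
      (BundlePullback.proj : PrincipalPullback hq f → B') where
  act_one _ := BundlePullback.ext rfl (hq.act_one _)
  act_mul _ _ _ := BundlePullback.ext rfl (hq.act_mul _ _ _)
  contMDiff_act := contMDiff_rightAct hq f
  proj_act _ _ := rfl
  exists_triv b := ⟨BundlePullback.pullTriv hq.isSmoothFiberBundle f (hq.triv (f b)),
    hq.mem_baseSet _,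
    BundlePullback.isSmoothTrivialization_pullTriv _ _ (hq.isSmoothTrivialization _),
    fun x hx g => hq.triv_act (f b) ((hq.triv (f b)).mem_source.2 (x.condition ▸ hx)) g⟩

end PrincipalPullback

variable [IsManifold IB ∞ B] [IsManifold IV ∞ V] [ContMDiffSMul IK IV ∞ K V]

namespace AssocPullback

variable (IV V)

theorem contMDiff_proj :
    ContMDiff (IB'.prod IV) IB' ∞ (BundlePullback.proj : AssocPullback IV V hq f → B') :=
  BundlePullback.contMDiff_proj _ f

theorem contMDiff_toTotal :
    ContMDiff (IB'.prod IV) (IB.prod IV) ∞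
      (BundlePullback.toTotal : AssocPullback IV V hq f → AssocBundle IV hq V) :=
  BundlePullback.contMDiff_toTotal _ f

theorem contMDiff_mk [LieGroup IK ∞ K] :
    ContMDiff ((IB'.prod IK).prod IV) (IB'.prod IV) ∞ (AssocPullback.mk IV V hq f) := fun x =>
  BundlePullback.contMDiffAt_of_components
    (ContMDiffAt.comp (g := BundlePullback.proj) (f := fun z => z.1) x
      (BundlePullback.contMDiff_proj hq.isSmoothFiberBundle f _) contMDiffAt_fst)
    ((AssocBundle.contMDiff_mk IV hq _).comp x
      ((ContMDiffAt.comp (g := BundlePullback.toTotal) (f := fun z => z.1) x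
        (BundlePullback.contMDiff_toTotal hq.isSmoothFiberBundle f _) contMDiffAt_fst).prodMk
          contMDiffAt_snd))

/-- The pull-back of an associated bundle is associated to the pull-back of the principal bundle. -/
theorem isAssociatedBundle [LieGroup IK ∞ K] :
    IsAssociatedBundle (IB'.prod IK) IV (PrincipalPullback.rightAct hq f) (IB'.prod IV)
      (AssocPullback.mk IV V hq f) where
  contMDiff := contMDiff_mk IV V hq f
  surjective y := by
    obtain ⟨⟨p, v⟩, h⟩ := (AssocBundle.isQuotientMap_mk (V := V) IV hq).surjective y.toTotal
    exact ⟨(⟨y.proj, p, y.condition.trans (congrArg (AssocBundle.proj IV V hq) h.symm)⟩, v),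
      BundlePullback.ext rfl h⟩
  eq_iff := by
    rintro ⟨x, v⟩ ⟨x', v'⟩
    constructor
    · intro h
      have h1 : x.proj = x'.proj := congrArg (fun y : AssocPullback IV V hq f => y.proj) h
      obtain ⟨g, hg⟩ := (AssocBundle.mk_eq_mk_iff (IV := IV) hq).1
        (congrArg (fun y : AssocPullback IV V hq f => y.toTotal) h)
      obtain ⟨h2, h3⟩ := Prod.mk.inj hg
      exact ⟨g, Prod.ext (BundlePullback.ext h1.symm h2) h3⟩
    · rintro ⟨g, hg⟩
      obtain ⟨rfl, rfl⟩ := Prod.mk.inj hg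
      exact BundlePullback.ext rfl (AssocBundle.mk_act IV hq x.toTotal v g).symm
  surjective_mfderiv := by
    rintro ⟨x, v⟩
    set e := hq.triv (f x.proj)
    have hx : f x.proj ∈ e.baseSet := hq.mem_baseSet _
    have hx' : π x.toTotal ∈ e.baseSet := x.condition ▸ hx
    set g := (e x.toTotal).2
    -- A local section of the quotient map; the choice of `g` makes it pass through `(x, v)`, so its
    -- tangent map provides preimages of tangent vectors.
    set σ : AssocPullback IV V hq f → PrincipalPullback hq f × V := fun y =>
      (BundlePullback.pullInv hq.isSmoothFiberBundle f e (y.proj, g),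
        (AssocBundle.localSection IV hq (f x.proj) g y.toTotal).2)
    have hσx : σ (AssocPullback.mk IV V hq f (x, v)) = (x, v) := by
      refine Prod.ext ?_ ?_
      · exact (BundlePullback.pullTriv hq.isSmoothFiberBundle f e).left_inv hx
      · exact congrArg (fun y : P × V => y.2) (AssocBundle.localSection_mk IV hq (f x.proj) hx' v)
    have hσ : MDifferentiableAt (IB'.prod IV) ((IB'.prod IK).prod IV) σ
        (AssocPullback.mk IV V hq f (x, v)) := by
      refine ContMDiffAt.mdifferentiableAt (n := ∞) (ContMDiffAt.prodMk ?_ ?_) (by simp)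
      · exact ((BundlePullback.isSmoothTrivialization_pullTriv hq.isSmoothFiberBundle f
          (hq.isSmoothTrivialization (f x.proj))).contMDiffAt_symm (y := (x.proj, g)) hx).comp
          (AssocPullback.mk IV V hq f (x, v))
          ((contMDiff_proj IV V hq f _).prodMk contMDiffAt_const)
      · exact ContMDiffAt.comp (g := fun y => (AssocBundle.localSection IV hq (f x.proj) g y).2)
          (AssocPullback.mk IV V hq f (x, v))
          (contMDiffAt_snd.comp (AssocBundle.mk IV V hq (x.toTotal, v))
          (AssocBundle.contMDiffAt_localSection IV hq (f x.proj) g hx')) (contMDiff_toTotal IV V hq f _)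
    intro w
    refine ⟨(mfderiv (IB'.prod IV) ((IB'.prod IK).prod IV) σ (AssocPullback.mk IV V hq f (x, v)) w :
      (EB' × EK) × EV), mfderiv_apply_of_eventuallyEq_id hσx ?_
        ((contMDiff_mk IV V hq f _).mdifferentiableAt (by simp)) hσ w⟩
    filter_upwards [(BundlePullback.continuous_proj _ f).continuousAt.preimage_mem_nhds
      ((e.open_baseSet.preimage f.contMDiff.continuous).mem_nhds hx)] with y hy
    have hy' : f y.proj ∈ e.baseSet := hy
    refine BundlePullback.ext rfl ?_
    change AssocBundle.mk IV V hq ((BundlePullback.pullInv hq.isSmoothFiberBundle f e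
      (y.proj, g)).toTotal, _) = y.toTotal
    rw [BundlePullback.toTotal_pullInv hq.isSmoothFiberBundle f e (y := (y.proj, g)) hy]
    have h := AssocBundle.mk_localSection IV hq (f x.proj) g (y := y.toTotal)
      (by rw [← y.condition]; exact hy')
    -- After `f y.proj` is identified with the projection of `y.toTotal`, the total part of `σ y` is
    -- the local section on the associated bundle over the original base.
    rw [AssocBundle.localSection, ← y.condition] at h
    exact h

end AssocPullback

/-! ### The connection associated to a principal connection -/

variable [IsManifold IP ∞ P]

theorem Connection.contMDiffAt_lift_comp (Γ : Connection IP IB π) {EN HN : Type*}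
    [NormedAddCommGroup EN] [NormedSpace ℝ EN] [TopologicalSpace HN]
    {IN : ModelWithCorners ℝ EN HN} {N : Type*} [TopologicalSpace N] [ChartedSpace HN N]
    {s : N → P} {x : N} (hs : ContMDiffAt IN IP ∞ s x) :
    ContMDiffAt IN 𝓘(ℝ, EB →L[ℝ] EP) ∞ (inTangentCoordinates IB IP (fun y => π (s y)) s
      (fun y => (Γ.lift (s y) : EB →L[ℝ] EP)) x) x :=
  ContMDiffAt.comp (f := s) x (Γ.smooth_lift (s x)) hs

namespace AssocBundle

variable (IV) (Γ : Connection IP IB π)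

/-- The horizontal lift of the associated connection at `[p, v]`, in terms of the
representative `(p, v)`. -/
def liftAux (x : P × V) : EB →L[ℝ] EB × EV :=
  (mfderiv IP (IB.prod IV) (fun p => mk IV V hq (p, x.2)) x.1 : EP →L[ℝ] EB × EV).comp
    (Γ.lift x.1 : EB →L[ℝ] EP)

variable {Γ} in
-- From `[p, v] = [pg, g⁻¹v]`, the map `[·, v]` is `[·, g⁻¹v]` after right translation by `g`. Right
-- translation carries the lift at `p` to the lift at `pg`, so the chain rule concludes.
theorem liftAux_congr (hΓ : Γ.IsPrincipal act) {x y : P × V} (h : mk IV V hq x = mk IV V hq y) :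
    liftAux IV hq Γ x = liftAux IV hq Γ y := by
  obtain ⟨g, rfl⟩ := (mk_eq_mk_iff hq).1 h
  obtain ⟨p, v⟩ := x
  ext1 u
  have h1 := mfderiv_apply_of_eventuallyEq_comp (I := IP) (I' := IP) (I'' := IB.prod IV) (x := p)
    (F := fun p => mk IV V hq (p, v)) (g := fun p => mk IV V hq (p, g⁻¹ • v))
    (f := fun p => act p g) rfl
    (Filter.Eventually.of_forall fun p => (mk_act IV hq p v g).symm)
    ((contMDiff_mk_left IV hq _ _).mdifferentiableAt (by simp))
    ((hq.contMDiff_act_right g p).mdifferentiableAt (by simp)) (Γ.lift p u)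
  have h2 : (mfderiv IP IP (fun p => act p g) p (Γ.lift p u) : EP) = Γ.lift (act p g) u := hΓ p g u
  rw [h2] at h1
  exact h1

theorem mfderiv_proj_liftAux (x : P × V) (u : EB) :
    (mfderiv (IB.prod IV) IB (proj IV V hq) (mk IV V hq x) (liftAux IV hq Γ x u) : EB) = u := by
  have h1 := mfderiv_apply_of_eventuallyEq_comp (I := IP) (I' := IB.prod IV) (I'' := IB) (x := x.1)
    (F := π) (g := proj IV V hq) (f := fun p => mk IV V hq (p, x.2)) rfl
    (Filter.Eventually.of_forall fun _ => rfl)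
    ((contMDiff_proj IV hq _).mdifferentiableAt (by simp))
    ((contMDiff_mk_left IV hq x.2 x.1).mdifferentiableAt (by simp)) (Γ.lift x.1 u)
  exact h1.symm.trans (Γ.mfderiv_lift x.1 u)

/-- Along a smooth `σ` the lift is the derivative of a smooth family composed with the lift of `Γ`.
The condition `hev` moves the base points from `[σ y]` to `y`. -/
theorem contMDiffAt_liftAux_comp {σ : AssocBundle IV hq V → P × V} {y₀ : AssocBundle IV hq V}
    (hσ : ContMDiffAt (IB.prod IV) (IP.prod IV) ∞ σ y₀)
    (hev : ∀ᶠ y in 𝓝 y₀, mk IV V hq (σ y) = y) :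
    ContMDiffAt (IB.prod IV) 𝓘(ℝ, EB →L[ℝ] EB × EV) ∞
      (inTangentCoordinates IB (IB.prod IV) (proj IV V hq) _root_.id
        (fun y => liftAux IV hq Γ (σ y)) y₀) y₀ := by
  have hσ1 : ContMDiffAt (IB.prod IV) IP ∞ (fun y => (σ y).1) y₀ := contMDiffAt_fst.comp y₀ hσ
  have hσ2 : ContMDiffAt (IB.prod IV) IV ∞ (fun y => (σ y).2) y₀ := contMDiffAt_snd.comp y₀ hσ
  have h1 := ContMDiffAt.mfderiv (x₀ := y₀) (I := IP) (I' := IB.prod IV) (J := IB.prod IV)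
    (m := ∞) (n := ∞) (fun (y : AssocBundle IV hq V) p => mk IV V hq (p, (σ y).2))
    (fun y => (σ y).1)
    ((contMDiff_mk IV hq _).comp (y₀, (σ y₀).1) (contMDiffAt_snd.prodMk
      (ContMDiffAt.comp (g := fun y => (σ y).2) (y₀, (σ y₀).1) hσ2 contMDiffAt_fst)))
    hσ1 (by simp)
  have h2 : ContMDiffAt (IB.prod IV) 𝓘(ℝ, EB →L[ℝ] EP) ∞
      (inTangentCoordinates IB IP (fun y => π (σ y).1) (fun y => (σ y).1)
        (fun y => (Γ.lift (σ y).1 : EB →L[ℝ] EP)) y₀) y₀ :=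
    Γ.contMDiffAt_lift_comp hσ1
  have h3 := (h1.clm_comp h2).congr_of_eventuallyEq
    (inTangentCoordinates_comp _ _ hσ1.continuousAt)
  refine h3.congr_of_eventuallyEq (inTangentCoordinates_congr ?_ ?_ (Filter.EventuallyEq.refl _ _))
  · filter_upwards [hev] with y hy
    exact congrArg (proj IV V hq) hy.symm
  · filter_upwards [hev] with y hy
    exact hy.symm

variable {Γ} in
/-- The connection associated to a principal connection. -/
def connection (hΓ : Γ.IsPrincipal act) :
    Connection (IB.prod IV) IB (proj IV V hq) where
  lift y := (liftAux IV hq Γ (Quotient.out y) :)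
  mfderiv_lift y u := by
    have h := mfderiv_proj_liftAux IV hq Γ (Quotient.out y) u
    have hy : mk IV V hq (Quotient.out y) = y := Quotient.out_eq y
    rw [hy] at h
    exact h
  smooth_lift y₀ := by
    have hb : proj IV V hq y₀ ∈ (hq.triv (proj IV V hq y₀)).baseSet := hq.mem_baseSet _
    have hev : ∀ᶠ y in 𝓝 y₀,
        mk IV V hq (localSection IV hq (proj IV V hq y₀) 1 y) = y := by
      filter_upwards [(continuous_proj IV hq).continuousAt.preimage_mem_nhds
        ((hq.triv (proj IV V hq y₀)).open_baseSet.mem_nhds hb)] with y hy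
      exact mk_localSection IV hq _ _ hy
    -- The representative `Quotient.out` need not depend continuously on the point; independence of
    -- the representative allows a smooth local section in its place.
    refine (contMDiffAt_liftAux_comp IV hq Γ (contMDiffAt_localSection IV hq _ _ hb)
      hev).congr_of_eventuallyEq
      (inTangentCoordinates_congr (Filter.EventuallyEq.refl _ _) (Filter.EventuallyEq.refl _ _) ?_)
    filter_upwards [hev] with y hy
    have hy' : mk IV V hq (Quotient.out y) = y := Quotient.out_eq y
    exact liftAux_congr IV hq hΓ (hy'.trans hy.symm)

variable {Γ} in
-- The defining condition prescribes the lift at each `[p, v]`, and every point has this form.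
theorem existsUnique_isAssociated (hΓ : Γ.IsPrincipal act) :
    ∃! Δ : Connection (IB.prod IV) IB (proj IV V hq), Γ.IsAssociated (mk IV V hq) Δ := by
  have h : Γ.IsAssociated (mk IV V hq) (connection IV hq hΓ) := fun p v u => by
    have hy : mk IV V hq (Quotient.out (mk IV V hq (p, v))) = mk IV V hq (p, v) :=
      Quotient.out_eq _
    exact (DFunLike.congr_fun (liftAux_congr IV hq hΓ hy) u).symm
  refine ⟨connection IV hq hΓ, h, fun Δ hΔ => Connection.ext (funext fun y => ?_)⟩
  obtain ⟨⟨p, v⟩, rfl⟩ := (isQuotientMap_mk IV hq).surjective y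
  exact ContinuousLinearMap.ext fun u => (hΔ p v u).symm.trans (h p v u)

end AssocBundle

/-! ### Pull-back preserves principal and associated connections -/

variable [LieGroup IK ∞ K]

namespace PrincipalPullback

/-- Both vectors project to `u`, because the action preserves the fibres. Their images in `TP` agree
because `toTotal` intertwines the two actions and `Γ` is equivariant. -/
theorem isPrincipal_of_isPullback {Γ : Connection IP IB π} (hΓ : Γ.IsPrincipal act)
    {Γ' : Connection (IB'.prod IK) IB' (BundlePullback.proj : PrincipalPullback hq f → B')}
    (h : Γ'.IsPullback BundlePullback.toTotal f Γ) : Γ'.IsPrincipal (rightAct hq f) := by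
  intro x g u
  have hR : MDifferentiableAt (IB'.prod IK) (IB'.prod IK) (fun x => rightAct hq f x g) x :=
    ((isPrincipalBundle hq f).contMDiff_act_right g x).mdifferentiableAt (by simp)
  have hp := BundlePullback.contMDiff_proj hq.isSmoothFiberBundle f
  have ht := BundlePullback.contMDiff_toTotal hq.isSmoothFiberBundle f
  refine BundlePullback.tangent_ext hq.isSmoothFiberBundle f (x := rightAct hq f x g) ?_ ?_
  · have h1 := mfderiv_apply_of_eventuallyEq_comp (I := IB'.prod IK) (I' := IB'.prod IK)
      (I'' := IB') (x := x) (F := BundlePullback.proj) (g := BundlePullback.proj)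
      (f := fun x => rightAct hq f x g) rfl (Filter.Eventually.of_forall fun _ => rfl)
      ((hp _).mdifferentiableAt (by simp)) hR (Γ'.lift x u)
    exact h1.symm.trans ((Γ'.mfderiv_lift x u).trans (Γ'.mfderiv_lift (rightAct hq f x g) u).symm)
  · have h1 := mfderiv_apply_of_eventuallyEq_comp (I := IB'.prod IK) (I' := IB'.prod IK)
      (I'' := IP) (x := x) (F := fun x => act (BundlePullback.toTotal x) g)
      (g := BundlePullback.toTotal)
      (f := fun x => rightAct hq f x g) rfl (Filter.Eventually.of_forall fun _ => rfl)
      ((ht _).mdifferentiableAt (by simp)) hR (Γ'.lift x u)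
    have h2 := mfderiv_apply_of_eventuallyEq_comp (I := IB'.prod IK) (I' := IP)
      (I'' := IP) (x := x) (F := fun x => act (BundlePullback.toTotal x) g)
      (g := fun p => act p g) (f := BundlePullback.toTotal) rfl
      (Filter.Eventually.of_forall fun _ => rfl)
      ((hq.contMDiff_act_right g _).mdifferentiableAt (by simp))
      ((ht _).mdifferentiableAt (by simp)) (Γ'.lift x u)
    have h3 : (mfderiv (IB'.prod IK) IP BundlePullback.toTotal x (Γ'.lift x u) : EP) =
      Γ.lift x.toTotal (mfderiv IB' IB f x.proj u : EB) := h x u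
    rw [h3] at h2
    have h4 : (mfderiv IP IP (fun p => act p g) x.toTotal
      (Γ.lift x.toTotal (mfderiv IB' IB f x.proj u : EB)) : EP) =
      Γ.lift (act x.toTotal g) (mfderiv IB' IB f x.proj u : EB) := hΓ _ _ _
    exact h1.symm.trans (h2.trans (h4.trans (h (rightAct hq f x g) u).symm))

end PrincipalPullback

namespace AssocPullback

variable (IV V)

/-- Both vectors project to `u`. In the associated bundle over `B` both become the lift of `Tf u`
with respect to `Δ`, because `toTotal` after the quotient map of the pull-back is the original
quotient map after `toTotal`. -/
theorem isAssociated_of_isPullback {Γ : Connection IP IB π}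
    {Δ : Connection (IB.prod IV) IB (AssocBundle.proj IV V hq)}
    (hΔ : Γ.IsAssociated (AssocBundle.mk IV V hq) Δ)
    {Γ' : Connection (IB'.prod IK) IB' (BundlePullback.proj : PrincipalPullback hq f → B')}
    (hΓ' : Γ'.IsPullback BundlePullback.toTotal f Γ)
    {Δ' : Connection (IB'.prod IV) IB' (BundlePullback.proj : AssocPullback IV V hq f → B')}
    (hΔ' : Δ'.IsPullback BundlePullback.toTotal f Δ) :
    Γ'.IsAssociated (AssocPullback.mk IV V hq f) Δ' := by
  intro x v u
  have hk : MDifferentiableAt (IB'.prod IK) (IB'.prod IV)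
      (fun x => AssocPullback.mk IV V hq f (x, v)) x :=
    ((contMDiff_mk IV V hq f).comp (contMDiff_id.prodMk contMDiff_const) x).mdifferentiableAt
      (by simp)
  refine BundlePullback.tangent_ext (AssocBundle.isSmoothFiberBundle (V := V) IV hq) f
    (x := AssocPullback.mk IV V hq f (x, v)) ?_ ?_
  · have h1 := mfderiv_apply_of_eventuallyEq_comp (I := IB'.prod IK) (I' := IB'.prod IV)
      (I'' := IB') (x := x) (F := BundlePullback.proj) (g := BundlePullback.proj)
      (f := fun x => AssocPullback.mk IV V hq f (x, v)) rfl
      (Filter.Eventually.of_forall fun _ => rfl)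
      ((contMDiff_proj IV V hq f _).mdifferentiableAt (by simp)) hk (Γ'.lift x u)
    exact h1.symm.trans ((Γ'.mfderiv_lift x u).trans
      (Δ'.mfderiv_lift (AssocPullback.mk IV V hq f (x, v)) u).symm)
  · have h1 := mfderiv_apply_of_eventuallyEq_comp (I := IB'.prod IK) (I' := IB'.prod IV)
      (I'' := IB.prod IV) (x := x)
      (F := fun x : PrincipalPullback hq f => AssocBundle.mk IV V hq (x.toTotal, v))
      (g := BundlePullback.toTotal) (f := fun x => AssocPullback.mk IV V hq f (x, v)) rfl
      (Filter.Eventually.of_forall fun _ => rfl)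
      ((contMDiff_toTotal IV V hq f _).mdifferentiableAt (by simp)) hk (Γ'.lift x u)
    have h2 := mfderiv_apply_of_eventuallyEq_comp (I := IB'.prod IK) (I' := IP)
      (I'' := IB.prod IV) (x := x)
      (F := fun x : PrincipalPullback hq f => AssocBundle.mk IV V hq (x.toTotal, v))
      (g := fun p => AssocBundle.mk IV V hq (p, v)) (f := BundlePullback.toTotal) rfl
      (Filter.Eventually.of_forall fun _ => rfl)
      ((AssocBundle.contMDiff_mk_left IV hq v _).mdifferentiableAt (by simp))
      ((BundlePullback.contMDiff_toTotal hq.isSmoothFiberBundle f x).mdifferentiableAt (by simp))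
      (Γ'.lift x u)
    have h3 : (mfderiv (IB'.prod IK) IP BundlePullback.toTotal x (Γ'.lift x u) : EP) =
      Γ.lift x.toTotal (mfderiv IB' IB f x.proj u : EB) := hΓ' x u
    rw [h3] at h2
    exact h1.symm.trans (h2.trans ((hΔ x.toTotal v _).trans
      (hΔ' (AssocPullback.mk IV V hq f (x, v)) u).symm))

end AssocPullback

end Principal

/-! ### Components of a principal connection and of its associated connection -/

section Coordinates

variable {EP HP : Type*} [NormedAddCommGroup EP] [NormedSpace ℝ EP] [TopologicalSpace HP]
  {EB HB : Type*} [NormedAddCommGroup EB] [NormedSpace ℝ EB] [TopologicalSpace HB]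
  {EK HK : Type*} [NormedAddCommGroup EK] [NormedSpace ℝ EK] [TopologicalSpace HK]
  {EV HV : Type*} [NormedAddCommGroup EV] [NormedSpace ℝ EV] [TopologicalSpace HV]
  {IP : ModelWithCorners ℝ EP HP} {IB : ModelWithCorners ℝ EB HB}
  {IK : ModelWithCorners ℝ EK HK} {IV : ModelWithCorners ℝ EV HV}
  {P : Type*} [TopologicalSpace P] [ChartedSpace HP P]
  {B : Type*} [TopologicalSpace B] [ChartedSpace HB B]
  {K : Type*} [TopologicalSpace K] [ChartedSpace HK K] [Group K]
  {V : Type*} [TopologicalSpace V] [ChartedSpace HV V] [MulAction K V]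
  {act : P → K → P} {π : P → B} {n d m r : ℕ}
  {C W : Type*} [NormedAddCommGroup C] [NormedSpace ℝ C] [NormedAddCommGroup W] [NormedSpace ℝ W]

/-- The partial-derivative formula for a coordinate space `C × W` regarded as one normed space with
its own model; the slices factor through the two affine inclusions. -/
theorem mfderiv_apply_prod_eq_add {Q : C × W → P} {y : C} {w : W}
    (hQ : MDifferentiableAt 𝓘(ℝ, C × W) IP Q (y, w)) (t : C) (s : W) :
    (mfderiv 𝓘(ℝ, C × W) IP Q (y, w) (t, s) : EP) =
      (mfderiv 𝓘(ℝ, C) IP (fun y => Q (y, w)) y t : EP) +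
        (mfderiv 𝓘(ℝ, W) IP (fun w => Q (y, w)) w s : EP) := by
  have h1 := mfderiv_apply_of_eventuallyEq_comp (I := 𝓘(ℝ, C)) (I' := 𝓘(ℝ, C × W)) (I'' := IP)
    (x := y) (F := fun y => Q (y, w)) (g := Q) (f := fun y => (y, w)) rfl
    (Filter.Eventually.of_forall fun _ => rfl) hQ
    (hasFDerivAt_prodMk_left y w).differentiableAt.mdifferentiableAt t
  have h2 := mfderiv_apply_of_eventuallyEq_comp (I := 𝓘(ℝ, W)) (I' := 𝓘(ℝ, C × W)) (I'' := IP)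
    (x := w) (F := fun w => Q (y, w)) (g := Q) (f := fun w => (y, w)) rfl
    (Filter.Eventually.of_forall fun _ => rfl) hQ
    (hasFDerivAt_prodMk_right y w).differentiableAt.mdifferentiableAt s
  rw [mfderiv_eq_fderiv, (hasFDerivAt_prodMk_left y w).fderiv] at h1
  rw [mfderiv_eq_fderiv, (hasFDerivAt_prodMk_right y w).fderiv] at h2
  rw [h1, h2]
  have h3 : ((t, s) : C × W) = (t, 0) + (0, s) := by simp
  rw [h3]
  exact map_add (mfderiv 𝓘(ℝ, C × W) IP Q (y, w)) _ _

theorem IsSmoothChart.contMDiffAt {φ : OpenPartialHomeomorph B C} (hφ : IsSmoothChart IB φ) {b : B}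
    (hb : b ∈ φ.source) : ContMDiffAt IB 𝓘(ℝ, C) ∞ φ b :=
  hφ.1.contMDiffAt (φ.open_source.mem_nhds hb)

theorem IsSmoothChart.contMDiffAt_symm {φ : OpenPartialHomeomorph B C} (hφ : IsSmoothChart IB φ)
    {y : C} (hy : y ∈ φ.target) : ContMDiffAt 𝓘(ℝ, C) IB ∞ φ.symm y :=
  hφ.2.contMDiffAt (φ.open_target.mem_nhds hy)

/-- The coordinates of the vector field on `V` representing an element of the Lie algebra. -/
theorem sum_mul_generatorComponent (ψ : OpenPartialHomeomorph V (Fin m → ℝ))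
    (e : Module.Basis (Fin r) ℝ (GroupLieAlgebra IK K)) (A : Fin r → ℝ) (w : Fin m → ℝ) :
    (fun i => ∑ a, A a * generatorComponent IV ψ e a i w) =
      (mfderiv IV 𝓘(ℝ, Fin m → ℝ) ψ (ψ.symm w)
        (generator IK IV (ψ.symm w) (∑ a, A a • e a)) : Fin m → ℝ) := by
  have h1 : generator IK IV (ψ.symm w) (∑ a, A a • e a) =
      ∑ a, A a • generator IK IV (ψ.symm w) (e a) := by
    simp only [generator, map_sum, map_smul]
    rfl
  rw [h1, map_sum]
  simp only [map_smul]
  ext i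
  refine Eq.trans ?_ (Finset.sum_apply i Finset.univ (fun a => (A a •
    mfderiv IV 𝓘(ℝ, Fin m → ℝ) ψ (ψ.symm w) (generator IK IV (ψ.symm w) (e a)) : Fin m → ℝ))).symm
  rfl

/-- The tangent maps of `ψ` and `ψ.symm` cancel. This supplies the coordinate vector `s` required by
`Connection.IsAssociated.lift_eq`. -/
theorem mfderiv_symm_sum_mul_generatorComponent {ψ : OpenPartialHomeomorph V (Fin m → ℝ)}
    (hψ : IsSmoothChart IV ψ) (e : Module.Basis (Fin r) ℝ (GroupLieAlgebra IK K)) (A : Fin r → ℝ)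
    {w : Fin m → ℝ} (hw : w ∈ ψ.target) :
    (mfderiv 𝓘(ℝ, Fin m → ℝ) IV ψ.symm w
      (fun i => ∑ a, A a * generatorComponent IV ψ e a i w : Fin m → ℝ) : EV) =
      generator IK IV (ψ.symm w) (∑ a, A a • e a) := by
  rw [sum_mul_generatorComponent]
  exact mfderiv_apply_of_eventuallyEq_id (ψ.right_inv hw)
    (by filter_upwards [ψ.open_source.mem_nhds (ψ.map_target hw)] with v hv
        exact ψ.left_inv hv) ((hψ.contMDiffAt_symm hw).mdifferentiableAt (by simp))
    ((hψ.contMDiffAt (ψ.map_target hw)).mdifferentiableAt (by simp)) _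

variable [IsManifold IP ∞ P] [IsManifold IB ∞ B]

/-- The components of a connection at a point and in a direction exist. -/
theorem exists_components [ContMDiffMul IK ∞ K] (hq : IsPrincipalBundle IP IB IK act π)
    (Γ : Connection IP IB π) {χ : OpenPartialHomeomorph B C} (hχ : IsSmoothChart IB χ) {U : Set B}
    {z : B → P} (hz : IsLocalSection IB IP π U z)
    (e : Module.Basis (Fin r) ℝ (GroupLieAlgebra IK K)) {y : C} (hy : y ∈ χ.target)
    (hU : χ.symm y ∈ U) (t : C) :
    ∃ c : Fin r → ℝ, (Γ.lift (z (χ.symm y)) (mfderiv 𝓘(ℝ, C) IB χ.symm y t : EB) : EP) =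
      (mfderiv 𝓘(ℝ, C) IP (fun y' => z (χ.symm y')) y t : EP) +
        verticalVector IP IK act (z (χ.symm y)) (∑ a, c a • e a) := by
  have hχs := hχ.contMDiffAt_symm hy
  have hζ : ContMDiffAt 𝓘(ℝ, C) IP ∞ (fun y' => z (χ.symm y')) y :=
    ContMDiffAt.comp (g := z) y (hz.2.1.contMDiffAt (hz.1.mem_nhds hU)) hχs
  have hev : ∀ᶠ y' in 𝓝 y, χ.symm y' ∈ U := hχs.continuousAt.preimage_mem_nhds (hz.1.mem_nhds hU)
  -- Since `z` is a section, the vector tangent to `z ∘ χ.symm` projects to the coordinate vector,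
  -- just as the horizontal lift does; their difference is therefore vertical.
  have h1 := mfderiv_apply_of_eventuallyEq_comp (I := 𝓘(ℝ, C)) (I' := IP) (I'' := IB) (x := y)
    (F := χ.symm) (g := π) (f := fun y' => z (χ.symm y')) rfl
    (hev.mono fun y' hy' => (hz.2.2 _ hy').symm) ((hq.contMDiff_proj _).mdifferentiableAt (by simp))
    (hζ.mdifferentiableAt (by simp)) t
  have h2 : (mfderiv IP IB π (z (χ.symm y))
      (Γ.lift (z (χ.symm y)) (mfderiv 𝓘(ℝ, C) IB χ.symm y t : EB)) : EB) =
      mfderiv 𝓘(ℝ, C) IB χ.symm y t := Γ.mfderiv_lift _ _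
  obtain ⟨ξ, hξ⟩ := hq.exists_verticalVector_eq (z (χ.symm y))
    ((Γ.lift (z (χ.symm y)) (mfderiv 𝓘(ℝ, C) IB χ.symm y t : EB) : EP) -
      (mfderiv 𝓘(ℝ, C) IP (fun y' => z (χ.symm y')) y t : EP))
    ((map_sub (mfderiv IP IB π (z (χ.symm y))) _ _).trans (by rw [h2]; exact sub_eq_zero.2 h1))
  refine ⟨e.repr ξ, ?_⟩
  rw [e.sum_repr, hξ]
  exact (add_sub_cancel _ _).symm

/-- `HasComponents` asks for no regularity of the functions, so a choice at each point and in each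
direction is enough. -/
theorem exists_hasComponents [ContMDiffMul IK ∞ K] (hq : IsPrincipalBundle IP IB IK act π)
    (Γ : Connection IP IB π) {χ : OpenPartialHomeomorph B ((Fin n → ℝ) × (Fin d → ℝ))}
    (hχ : IsSmoothChart IB χ) {U : Set B} {z : B → P} (hz : IsLocalSection IB IP π U z)
    (e : Module.Basis (Fin r) ℝ (GroupLieAlgebra IK K)) :
    ∃ Ax As, HasComponents act Γ χ U z e Ax As := by
  have h : ∀ (y t : (Fin n → ℝ) × (Fin d → ℝ)), ∃ c : Fin r → ℝ, y ∈ χ.target → χ.symm y ∈ U →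
      (Γ.lift (z (χ.symm y))
        (mfderiv 𝓘(ℝ, (Fin n → ℝ) × (Fin d → ℝ)) IB χ.symm y t : EB) : EP) =
      (mfderiv 𝓘(ℝ, (Fin n → ℝ) × (Fin d → ℝ)) IP (fun y' => z (χ.symm y')) y t : EP) +
        verticalVector IP IK act (z (χ.symm y)) (∑ a, c a • e a) := fun y t => by
    -- Outside the domain nothing is required, and zero serves as a default.
    by_cases hy : y ∈ χ.target ∧ χ.symm y ∈ U
    · obtain ⟨c, hc⟩ := exists_components hq Γ hχ hz e hy.1 hy.2 t
      exact ⟨c, fun _ _ => hc⟩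
    · exact ⟨0, fun h1 h2 => absurd ⟨h1, h2⟩ hy⟩
  choose c hc using h
  exact ⟨fun a l y => c y (Pi.single l 1, 0) a, fun a j y => c y (0, Pi.single j 1) a,
    fun y hy hU => ⟨fun l => hc y _ hy hU, fun j => hc y _ hy hU⟩⟩

/-- The horizontal lift of a vector `∂_l + D^j ∂_j` in terms of the components of a connection. -/
theorem HasComponents.lift_apply {Γ : Connection IP IB π}
    {χ : OpenPartialHomeomorph B ((Fin n → ℝ) × (Fin d → ℝ))} {U : Set B} {z : B → P}
    {e : Module.Basis (Fin r) ℝ (GroupLieAlgebra IK K)}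
    {Ax : Fin r → Fin n → (Fin n → ℝ) × (Fin d → ℝ) → ℝ}
    {As : Fin r → Fin d → (Fin n → ℝ) × (Fin d → ℝ) → ℝ}
    (h : HasComponents act Γ χ U z e Ax As) {y : (Fin n → ℝ) × (Fin d → ℝ)} (hy : y ∈ χ.target)
    (hU : χ.symm y ∈ U) (l : Fin n) (D : Fin d → ℝ) :
    (Γ.lift (z (χ.symm y)) (mfderiv 𝓘(ℝ, (Fin n → ℝ) × (Fin d → ℝ)) IB χ.symm y (Pi.single l 1, D) : EB) : EP) =
      (mfderiv 𝓘(ℝ, (Fin n → ℝ) × (Fin d → ℝ)) IP (fun y' => z (χ.symm y')) y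
        (Pi.single l 1, D) : EP) +
        verticalVector IP IK act (z (χ.symm y))
          (∑ a, ((∑ j, As a j y * D j) + Ax a l y) • e a) := by
  obtain ⟨h1, h2⟩ := h y hy hU
  have hD : ((Pi.single l 1, D) : (Fin n → ℝ) × (Fin d → ℝ)) =
      (Pi.single l 1, 0) + ∑ j, D j • ((0, Pi.single j 1) : (Fin n → ℝ) × (Fin d → ℝ)) := by
    refine Prod.ext ?_ ?_
    · simp [Prod.fst_sum]
    · ext i
      simp [Prod.snd_sum, Finset.sum_apply, Pi.single_apply]
  have hξ : (∑ a, ((∑ j, As a j y * D j) + Ax a l y) • e a) =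
      (∑ a, Ax a l y • e a) + ∑ j, D j • ∑ a, As a j y • e a := by
    simp only [add_smul, Finset.sum_add_distrib, Finset.sum_smul, Finset.smul_sum, smul_smul]
    rw [add_comm, Finset.sum_comm]
    simp only [mul_comm]
  -- The lift, the tangent map of the section and the vertical map become linear maps between fixed
  -- model spaces, so that linearity applies without dependent tangent spaces.
  set L : (Fin n → ℝ) × (Fin d → ℝ) →L[ℝ] EP :=
    (Γ.lift (z (χ.symm y)) : EB →L[ℝ] EP).comp
      (mfderiv 𝓘(ℝ, (Fin n → ℝ) × (Fin d → ℝ)) IB χ.symm y)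
  set T : (Fin n → ℝ) × (Fin d → ℝ) →L[ℝ] EP :=
    mfderiv 𝓘(ℝ, (Fin n → ℝ) × (Fin d → ℝ)) IP (fun y' => z (χ.symm y')) y
  set N : GroupLieAlgebra IK K →L[ℝ] EP :=
    mfderiv IK IP (fun g : K => act (z (χ.symm y)) g) 1
  have h1' : L (Pi.single l 1, 0) = T (Pi.single l 1, 0) + N (∑ a, Ax a l y • e a) := h1 l
  have h2' : ∀ j, L (0, Pi.single j 1) = T (0, Pi.single j 1) + N (∑ a, As a j y • e a) := h2
  change L (Pi.single l 1, D) = T (Pi.single l 1, D) +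
    N (∑ a, ((∑ j, As a j y * D j) + Ax a l y) • e a)
  rw [hD, hξ]
  simp only [map_add L, map_add T, map_add N, map_sum L, map_sum T, map_sum N, map_smul L,
    map_smul T, map_smul N, h1', h2', smul_add, Finset.sum_add_distrib]
  abel

variable [IsManifold IV ∞ V] [ContMDiffSMul IK IV ∞ K V]

/-- If the horizontal lift of `u` with respect to `Γ` is the sum of a vector tangent to a map `ζ`
and the vertical vector defined by `ξ`, then the horizontal lift with respect to the associated
connection is obtained by replacing the latter with the vector field on `V` representing `ξ`. -/
theorem Connection.IsAssociated.lift_eq {hq : IsPrincipalBundle IP IB IK act π}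
    {Γ : Connection IP IB π} {Δ : Connection (IB.prod IV) IB (AssocBundle.proj IV V hq)}
    (hΔ : Γ.IsAssociated (AssocBundle.mk IV V hq) Δ) {ζ : C → P} {η : W → V} {y : C} {w : W}
    (hζ : ContMDiffAt 𝓘(ℝ, C) IP ∞ ζ y) (hη : ContMDiffAt 𝓘(ℝ, W) IV ∞ η w) {u : EB} {t : C} {s : W}
    {ξ : GroupLieAlgebra IK K}
    (h : (Γ.lift (ζ y) u : EP) =
      (mfderiv 𝓘(ℝ, C) IP ζ y t : EP) + verticalVector IP IK act (ζ y) ξ)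
    (hs : (mfderiv 𝓘(ℝ, W) IV η w s : EV) = generator IK IV (η w) ξ) :
    (Δ.lift (AssocBundle.mk IV V hq (ζ y, η w)) u : EB × EV) =
      mfderiv 𝓘(ℝ, C × W) (IB.prod IV) (fun q : C × W => AssocBundle.mk IV V hq (ζ q.1, η q.2))
        (y, w) (t, s) := by
  have hQ : ContMDiffAt 𝓘(ℝ, C × W) (IB.prod IV) ∞
      (fun q : C × W => AssocBundle.mk IV V hq (ζ q.1, η q.2)) (y, w) :=
    (AssocBundle.contMDiff_mk IV hq _).comp (y, w)
      ((ContMDiffAt.comp (f := Prod.fst) (y, w) hζ contDiff_fst.contMDiff.contMDiffAt).prodMk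
        (ContMDiffAt.comp (f := Prod.snd) (y, w) hη contDiff_snd.contMDiff.contMDiffAt))
  rw [mfderiv_apply_prod_eq_add (hQ.mdifferentiableAt (by simp))]
  have h1 := mfderiv_apply_of_eventuallyEq_comp (I := 𝓘(ℝ, C)) (I' := IP) (I'' := IB.prod IV)
    (x := y) (F := fun y => AssocBundle.mk IV V hq (ζ y, η w))
    (g := fun p => AssocBundle.mk IV V hq (p, η w)) (f := ζ) rfl
    (Filter.Eventually.of_forall fun _ => rfl)
    ((AssocBundle.contMDiff_mk_left IV hq _ _).mdifferentiableAt (by simp))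
    (hζ.mdifferentiableAt (by simp)) t
  have h2 := mfderiv_apply_of_eventuallyEq_comp (I := 𝓘(ℝ, W)) (I' := IV) (I'' := IB.prod IV)
    (x := w) (F := fun w => AssocBundle.mk IV V hq (ζ y, η w))
    (g := fun v => AssocBundle.mk IV V hq (ζ y, v)) (f := η) rfl
    (Filter.Eventually.of_forall fun _ => rfl)
    ((AssocBundle.contMDiff_mk_right IV hq _ _).mdifferentiableAt (by simp))
    (hη.mdifferentiableAt (by simp)) s
  -- The fibre direction is rewritten as the image of the vertical vector of `ξ`, so both summands
  -- become images under the tangent map of `[·, η w]` and add up to the image of the lift.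
  rw [hs, ← AssocBundle.mfderiv_mk_verticalVector] at h2
  have h3 : (mfderiv IP (IB.prod IV) (fun p => AssocBundle.mk IV V hq (p, η w)) (ζ y)
      (Γ.lift (ζ y) u) : EB × EV) = Δ.lift (AssocBundle.mk IV V hq (ζ y, η w)) u := hΔ (ζ y) (η w) u
  rw [h1, h2, ← h3, h]
  exact map_add (mfderiv IP (IB.prod IV) (fun p => AssocBundle.mk IV V hq (p, η w)) (ζ y)) _ _

end Coordinates

/-! ### Coordinate expression of the pull-back connection -/

section PullbackCoordinates

variable {EP HP : Type*} [NormedAddCommGroup EP] [NormedSpace ℝ EP] [TopologicalSpace HP]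
  {EB HB : Type*} [NormedAddCommGroup EB] [NormedSpace ℝ EB] [TopologicalSpace HB]
  {EK HK : Type*} [NormedAddCommGroup EK] [NormedSpace ℝ EK] [TopologicalSpace HK]
  {EV HV : Type*} [NormedAddCommGroup EV] [NormedSpace ℝ EV] [TopologicalSpace HV]
  {IP : ModelWithCorners ℝ EP HP} {IB : ModelWithCorners ℝ EB HB}
  {IK : ModelWithCorners ℝ EK HK} {IV : ModelWithCorners ℝ EV HV}
  {P : Type*} [TopologicalSpace P] [ChartedSpace HP P]
  {B : Type*} [TopologicalSpace B] [ChartedSpace HB B]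
  {K : Type*} [TopologicalSpace K] [ChartedSpace HK K] [Group K]
  {V : Type*} [TopologicalSpace V] [ChartedSpace HV V] [MulAction K V]
  {act : P → K → P} {π : P → B}
  {EB' HB' : Type*} [NormedAddCommGroup EB'] [NormedSpace ℝ EB'] [TopologicalSpace HB']
  {IB' : ModelWithCorners ℝ EB' HB'} {B' : Type*} [TopologicalSpace B'] [ChartedSpace HB' B']
  {C W : Type*} [NormedAddCommGroup C] [NormedSpace ℝ C] [NormedAddCommGroup W] [NormedSpace ℝ W]
  {n d m r : ℕ}
  {hq : IsPrincipalBundle IP IB IK act π} {f : C^∞⟮IB', B'; IB, B⟯}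

theorem PrincipalPullback.toTotal_sectionPullback {z : B → P} {x : B'} (h : f x = π (z (f x))) :
    (sectionPullback hq f z x).toTotal = z (f x) := by
  rw [sectionPullback, dif_pos h]

theorem PrincipalPullback.proj_sectionPullback (z : B → P) (x : B') :
    (sectionPullback hq f z x).proj = x := by
  unfold sectionPullback
  split_ifs <;> rfl

variable [IsManifold IB ∞ B] [IsManifold IV ∞ V] [IsManifold IB' ∞ B'] [ContMDiffSMul IK IV ∞ K V]

/-- A horizontal lift of the pull-back of an associated connection `Δ`, in terms of a lift
with respect to `Δ`, along the pull-back of a local section. -/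
theorem AssocPullback.lift_eq {Δ : Connection (IB.prod IV) IB (AssocBundle.proj IV V hq)}
    {Δ' : Connection (IB'.prod IV) IB' (BundlePullback.proj : AssocPullback IV V hq f → B')}
    (hΔ' : Δ'.IsPullback BundlePullback.toTotal f Δ) {U : Set B} {z : B → P}
    (hz : IsLocalSection IB IP π U z) {γ : C → B'} {η : W → V} {x : C} {w : W}
    (hγ : ContMDiffAt 𝓘(ℝ, C) IB' ∞ γ x) (hη : ContMDiffAt 𝓘(ℝ, W) IV ∞ η w)
    (hU : f (γ x) ∈ U) {t : C} {s : W}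
    (h : (Δ.lift (AssocBundle.mk IV V hq (z (f (γ x)), η w))
        (mfderiv IB' IB f (γ x) (mfderiv 𝓘(ℝ, C) IB' γ x t : EB') : EB) : EB × EV) =
      mfderiv 𝓘(ℝ, C × W) (IB.prod IV)
        (fun q : C × W => AssocBundle.mk IV V hq (z (f (γ q.1)), η q.2)) (x, w) (t, s)) :
    (Δ'.lift (AssocPullback.mk IV V hq f (PrincipalPullback.sectionPullback hq f z (γ x), η w))
      (mfderiv 𝓘(ℝ, C) IB' γ x t : EB') : EB' × EV) =
      mfderiv 𝓘(ℝ, C × W) (IB'.prod IV) (fun q : C × W => AssocPullback.mk IV V hq f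
        (PrincipalPullback.sectionPullback hq f z (γ q.1), η q.2)) (x, w) (t, s) := by
  set Q : C × W → AssocPullback IV V hq f := fun q => AssocPullback.mk IV V hq f
    (PrincipalPullback.sectionPullback hq f z (γ q.1), η q.2)
  have hγ1 : ContMDiffAt 𝓘(ℝ, C × W) IB' ∞ (fun q : C × W => γ q.1) (x, w) :=
    ContMDiffAt.comp (f := Prod.fst) (x, w) hγ contDiff_fst.contMDiff.contMDiffAt
  have hη2 : ContMDiffAt 𝓘(ℝ, C × W) IV ∞ (fun q : C × W => η q.2) (x, w) :=
    ContMDiffAt.comp (f := Prod.snd) (x, w) hη contDiff_snd.contMDiff.contMDiffAt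
  have hfγ : ContMDiffAt 𝓘(ℝ, C × W) IB ∞ (fun q : C × W => f (γ q.1)) (x, w) :=
    ContMDiffAt.comp (g := f) (x, w) (f.contMDiff _) hγ1
  have hζ : ContMDiffAt 𝓘(ℝ, C × W) (IB.prod IV) ∞
      (fun q : C × W => AssocBundle.mk IV V hq (z (f (γ q.1)), η q.2)) (x, w) :=
    (AssocBundle.contMDiff_mk IV hq _).comp (x, w) ((ContMDiffAt.comp (g := z) (x, w)
      (hz.2.1.contMDiffAt (hz.1.mem_nhds hU)) hfγ).prodMk hη2)
  have hp : ∀ q, (Q q).proj = γ q.1 := fun q => PrincipalPullback.proj_sectionPullback z (γ q.1)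
  -- The pulled-back section has total part `z ∘ f` only where `z` is a section; elsewhere it may
  -- take its default value.
  have ht' : ∀ q : C × W, f (γ q.1) ∈ U →
      (Q q).toTotal = AssocBundle.mk IV V hq (z (f (γ q.1)), η q.2) := fun q hq' =>
    congrArg (fun p => AssocBundle.mk IV V hq (p, η q.2))
      (PrincipalPullback.toTotal_sectionPullback (hz.2.2 _ hq').symm)
  have ht : (fun q => (Q q).toTotal) =ᶠ[𝓝 (x, w)]
      fun q => AssocBundle.mk IV V hq (z (f (γ q.1)), η q.2) := by
    filter_upwards [hfγ.continuousAt.preimage_mem_nhds (hz.1.mem_nhds hU)] with q hq'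
    exact ht' q hq'
  have hQs : MDifferentiableAt 𝓘(ℝ, C × W) (IB'.prod IV) Q (x, w) :=
    (BundlePullback.contMDiffAt_of_components (hγ1.congr_of_eventuallyEq
      (Filter.Eventually.of_forall hp)) (hζ.congr_of_eventuallyEq ht)).mdifferentiableAt (by simp)
  refine BundlePullback.tangent_ext (AssocBundle.isSmoothFiberBundle (V := V) IV hq) f
    (x := Q (x, w)) ?_ ?_
  · have h1 := mfderiv_apply_of_eventuallyEq_comp (I := 𝓘(ℝ, C × W)) (I' := IB'.prod IV)
      (I'' := IB') (x := (x, w)) (F := fun q : C × W => γ q.1) (g := BundlePullback.proj) (f := Q)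
      rfl (Filter.Eventually.of_forall fun q => (hp q).symm)
      ((contMDiff_proj IV V hq f _).mdifferentiableAt (by simp)) hQs (t, s)
    have h2 := mfderiv_apply_of_eventuallyEq_comp (I := 𝓘(ℝ, C × W)) (I' := 𝓘(ℝ, C))
      (I'' := IB') (x := (x, w)) (F := fun q : C × W => γ q.1) (g := γ) (f := Prod.fst)
      rfl (Filter.Eventually.of_forall fun q => rfl) (hγ.mdifferentiableAt (by simp))
      (contDiff_fst.contMDiff.contMDiffAt.mdifferentiableAt (n := ∞) (by simp)) (t, s)
    rw [mfderiv_eq_fderiv, fderiv_fst] at h2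
    exact (Δ'.mfderiv_lift (Q (x, w)) _).trans (h2.symm.trans h1)
  · have h1 := mfderiv_apply_of_eventuallyEq_comp (I := 𝓘(ℝ, C × W)) (I' := IB'.prod IV)
      (I'' := IB.prod IV) (x := (x, w))
      (F := fun q : C × W => AssocBundle.mk IV V hq (z (f (γ q.1)), η q.2))
      (g := BundlePullback.toTotal) (f := Q) rfl ht.symm
      ((contMDiff_toTotal IV V hq f _).mdifferentiableAt (by simp)) hQs (t, s)
    refine Eq.trans ?_ (h.trans h1)
    refine (hΔ' (Q (x, w)) _).trans ?_
    -- The base points of `Q (x, w)` are equal to the expected ones only propositionally and occur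
    -- in the types; quantifying over equal points makes the transport trivial.
    have h3 : ∀ b, b = γ x → ∀ y, y = AssocBundle.mk IV V hq (z (f (γ x)), η w) → ∀ u : EB',
        (Δ.lift y (mfderiv IB' IB f b u : EB) : EB × EV) =
        Δ.lift (AssocBundle.mk IV V hq (z (f (γ x)), η w)) (mfderiv IB' IB f (γ x) u : EB) := by
      rintro _ rfl _ rfl _
      rfl
    exact h3 _ (hp (x, w)) _ (ht' (x, w) hU) _

variable [IsManifold IP ∞ P]

/-- The horizontal lifts of the pull-back of an associated connection by a section, in terms of the
components of the connection on the principal bundle. -/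
theorem AssocPullback.lift_eq_of_hasComponents {Γ : Connection IP IB π}
    {Δ : Connection (IB.prod IV) IB (AssocBundle.proj IV V hq)}
    (hΔ : Γ.IsAssociated (AssocBundle.mk IV V hq) Δ)
    {Δ' : Connection (IB'.prod IV) IB' (BundlePullback.proj : AssocPullback IV V hq f → B')}
    (hΔ' : Δ'.IsPullback BundlePullback.toTotal f Δ) {ρ : B → B'} (hf : ∀ x, ρ (f x) = x)
    {φ : OpenPartialHomeomorph B' (Fin n → ℝ)}
    {χ : OpenPartialHomeomorph B ((Fin n → ℝ) × (Fin d → ℝ))}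
    {ψ : OpenPartialHomeomorph V (Fin m → ℝ)} {U : Set B} {z : B → P}
    {e : Module.Basis (Fin r) ℝ (GroupLieAlgebra IK K)}
    (hφ : IsSmoothChart IB' φ) (hχ : IsSmoothChart IB χ) (hφχ : IsFibredChart ρ φ χ)
    (hψ : IsSmoothChart IV ψ) (hz : IsLocalSection IB IP π U z)
    {Ax : Fin r → Fin n → (Fin n → ℝ) × (Fin d → ℝ) → ℝ}
    {As : Fin r → Fin d → (Fin n → ℝ) × (Fin d → ℝ) → ℝ}
    (h : HasComponents act Γ χ U z e Ax As) {x : Fin n → ℝ} (hx : x ∈ φ.target)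
    (hfx : f (φ.symm x) ∈ χ.source ∩ U) {w : Fin m → ℝ} (hw : w ∈ ψ.target) (l : Fin n) :
    (Δ'.lift (AssocPullback.mk IV V hq f
        (PrincipalPullback.sectionPullback hq f z (φ.symm x), ψ.symm w))
      (mfderiv 𝓘(ℝ, Fin n → ℝ) IB' φ.symm x (Pi.single l 1) : EB') : EB' × EV) =
    mfderiv 𝓘(ℝ, (Fin n → ℝ) × (Fin m → ℝ)) (IB'.prod IV)
      (fun q : (Fin n → ℝ) × (Fin m → ℝ) => AssocPullback.mk IV V hq f
        (PrincipalPullback.sectionPullback hq f z (φ.symm q.1), ψ.symm q.2)) (x, w)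
      (Pi.single l 1, fun i => ∑ a,
        ((∑ j, As a j (x, (χ (f (φ.symm x))).2) *
            fderiv ℝ (fun x' => (χ (f (φ.symm x'))).2 j) x (Pi.single l 1)) +
          Ax a l (x, (χ (f (φ.symm x))).2)) * generatorComponent IV ψ e a i w) := by
  have hφs := hφ.contMDiffAt_symm hx
  have hfφ : ContMDiffAt 𝓘(ℝ, Fin n → ℝ) IB ∞ (fun x => f (φ.symm x)) x :=
    ContMDiffAt.comp (g := f) x (f.contMDiff _) hφs
  -- The coordinate expression `x ↦ (x, h(x))` of the section. Its first component is `x` because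
  -- `χ` is fibred over `φ` and `f` is a section of `ρ`.
  set c : (Fin n → ℝ) → (Fin n → ℝ) × (Fin d → ℝ) := fun x => χ (f (φ.symm x)) with hc
  have hcs : ContMDiffAt 𝓘(ℝ, Fin n → ℝ) 𝓘(ℝ, (Fin n → ℝ) × (Fin d → ℝ)) ∞ c x :=
    ContMDiffAt.comp (g := χ) x (hχ.contMDiffAt hfx.1) hfφ
  have hcd : DifferentiableAt ℝ c x := (hcs.mdifferentiableAt (by simp)).differentiableAt
  have hsrc : ∀ᶠ x' in 𝓝 x, x' ∈ φ.target ∧ f (φ.symm x') ∈ χ.source :=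
    Filter.Eventually.and (φ.open_target.mem_nhds hx)
      (hfφ.continuousAt.preimage_mem_nhds (χ.open_source.mem_nhds hfx.1))
  have hc1 : ∀ x', x' ∈ φ.target ∧ f (φ.symm x') ∈ χ.source → (c x').1 = x' := fun x' hx' => by
    rw [hc]
    exact ((hφχ _ hx'.2).2.trans (congrArg φ (hf _))).trans (φ.right_inv hx'.1)
  have hcx : (x, (c x).2) = c x := Prod.ext (hc1 x ⟨hx, hfx.1⟩).symm rfl
  set D : Fin d → ℝ := fun j => fderiv ℝ (fun x' => (c x').2 j) x (Pi.single l 1)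
  have hcD : (fderiv ℝ c x (Pi.single l 1)) = (Pi.single l 1, D) := by
    -- The first component of `c` is the identity near `x`, which contributes `∂_l`; the second
    -- contributes the derivatives `∂_l h^j`.
    refine Prod.ext ?_ (funext fun j => ?_)
    · have h1 : (fun x' => (c x').1) =ᶠ[𝓝 x] id := hsrc.mono hc1
      have h2 := h1.fderiv_eq (𝕜 := ℝ)
      rw [fderiv_id, fderiv.fst hcd] at h2
      exact DFunLike.congr_fun h2 (Pi.single l 1)
    · have h1 := ((hasFDerivAt_apply j (c x).2).comp x hcd.hasFDerivAt.snd).fderiv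
      exact (DFunLike.congr_fun h1 (Pi.single l 1)).symm
  have hcM : (mfderiv 𝓘(ℝ, Fin n → ℝ) 𝓘(ℝ, (Fin n → ℝ) × (Fin d → ℝ)) c x
      (Pi.single l 1 : Fin n → ℝ) : (Fin n → ℝ) × (Fin d → ℝ)) = (Pi.single l 1, D) := by
    rw [mfderiv_eq_fderiv]
    exact hcD
  have hcy : c x ∈ χ.target := χ.map_source hfx.1
  have hχc : χ.symm (c x) = f (φ.symm x) := χ.left_inv hfx.1
  have hχs := hχ.contMDiffAt_symm hcy
  have hcU : χ.symm (c x) ∈ U := hχc ▸ hfx.2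
  -- `f ∘ φ.symm` equals `χ.symm ∘ c` near `x`; differentiating it both ways expresses `Tf ∂_l` as
  -- `∂_l + ∂_l h^j ∂_j`.
  have hT1 : (mfderiv IB' IB f (φ.symm x)
      (mfderiv 𝓘(ℝ, Fin n → ℝ) IB' φ.symm x (Pi.single l 1) : EB') : EB) =
      mfderiv 𝓘(ℝ, (Fin n → ℝ) × (Fin d → ℝ)) IB χ.symm (c x) (Pi.single l 1, D) := by
    have h1 := mfderiv_apply_of_eventuallyEq_comp (I := 𝓘(ℝ, Fin n → ℝ)) (I' := IB') (I'' := IB)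
      (x := x) (F := fun x => f (φ.symm x)) (g := f) (f := φ.symm) rfl
      (Filter.Eventually.of_forall fun _ => rfl) ((f.contMDiff _).mdifferentiableAt (by simp))
      (hφs.mdifferentiableAt (by simp)) (Pi.single l 1)
    have h2 := mfderiv_apply_of_eventuallyEq_comp (I := 𝓘(ℝ, Fin n → ℝ))
      (I' := 𝓘(ℝ, (Fin n → ℝ) × (Fin d → ℝ))) (I'' := IB)
      (x := x) (F := fun x => f (φ.symm x)) (g := χ.symm) (f := c) rfl
      (hsrc.mono fun x' hx' => (χ.left_inv hx'.2).symm) (hχs.mdifferentiableAt (by simp))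
      (hcs.mdifferentiableAt (by simp)) (Pi.single l 1)
    rw [hcM] at h2
    exact h1.symm.trans h2
  have hT2 : (mfderiv 𝓘(ℝ, Fin n → ℝ) IP (fun x => z (f (φ.symm x))) x (Pi.single l 1) : EP) =
      mfderiv 𝓘(ℝ, (Fin n → ℝ) × (Fin d → ℝ)) IP (fun y => z (χ.symm y)) (c x)
        (Pi.single l 1, D) := by
    have h1 := mfderiv_apply_of_eventuallyEq_comp (I := 𝓘(ℝ, Fin n → ℝ))
      (I' := 𝓘(ℝ, (Fin n → ℝ) × (Fin d → ℝ))) (I'' := IP)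
      (x := x) (F := fun x => z (f (φ.symm x))) (g := fun y => z (χ.symm y)) (f := c) rfl
      (hsrc.mono fun x' hx' => congrArg z (χ.left_inv hx'.2).symm)
      ((ContMDiffAt.comp (g := z) (c x) (hz.2.1.contMDiffAt (hz.1.mem_nhds hcU))
        hχs).mdifferentiableAt (by simp))
      (hcs.mdifferentiableAt (by simp)) (Pi.single l 1)
    rwa [hcM] at h1
  rw [hcx]
  refine lift_eq hΔ' hz hφs (hψ.contMDiffAt_symm hw) hfx.2 ?_
  refine hΔ.lift_eq (ζ := fun x => z (f (φ.symm x))) (ContMDiffAt.comp (g := z) x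
    (hz.2.1.contMDiffAt (hz.1.mem_nhds hfx.2)) hfφ) (hψ.contMDiffAt_symm hw) ?_
    (mfderiv_symm_sum_mul_generatorComponent hψ e _ hw)
  have hp : z (χ.symm (c x)) = z (f (φ.symm x)) := congrArg z hχc
  rw [hT1]
  -- The components are given at `z (χ.symm (c x))` and the lift is wanted at `z (f (φ.symm x))`;
  -- `hp` identifies these points before and after `lift_apply`.
  refine (congrArg (fun p => (Γ.lift p (mfderiv 𝓘(ℝ, (Fin n → ℝ) × (Fin d → ℝ)) IB χ.symm (c x)
    (Pi.single l 1, D) : EB) : EP)) hp.symm).trans ((h.lift_apply hcy hcU l D).trans ?_)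
  exact congrArg₂ (fun a b : EP => a + b) hT2.symm
    (congrArg (fun p => (verticalVector IP IK act p _ : EP)) hp)

end PullbackCoordinates

end Gauge

end

/-! ### Induced connections over `P / H` and their restriction along sections -/

theorem mainTheorem5
    -- the base manifold `X`, the Lie group `G`, its closed Lie subgroup `H`, the manifolds `P`,
    -- `S = P / H` and the typical fibre `V`
    {EX EG EH EP ES EV : Type*}
    [NormedAddCommGroup EX] [NormedSpace ℝ EX] [FiniteDimensional ℝ EX]
    [NormedAddCommGroup EG] [NormedSpace ℝ EG] [FiniteDimensional ℝ EG]
    [NormedAddCommGroup EH] [NormedSpace ℝ EH] [FiniteDimensional ℝ EH]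
    [NormedAddCommGroup EP] [NormedSpace ℝ EP] [FiniteDimensional ℝ EP]
    [NormedAddCommGroup ES] [NormedSpace ℝ ES] [FiniteDimensional ℝ ES]
    [NormedAddCommGroup EV] [NormedSpace ℝ EV] [FiniteDimensional ℝ EV]
    {X : Type*} [TopologicalSpace X] [ChartedSpace EX X] [IsManifold 𝓘(ℝ, EX) ∞ X]
    {G : Type*} [TopologicalSpace G] [ChartedSpace EG G] [Group G] [LieGroup 𝓘(ℝ, EG) ∞ G]
    (H : Subgroup G) (_hclosed : IsClosed (H : Set G))
    [ChartedSpace EH H] [LieGroup 𝓘(ℝ, EH) ∞ H]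
    (_hembedding : Manifold.IsSmoothEmbedding 𝓘(ℝ, EH) 𝓘(ℝ, EG) ∞ (Subtype.val : H → G))
    {P : Type*} [TopologicalSpace P] [ChartedSpace EP P] [IsManifold 𝓘(ℝ, EP) ∞ P]
    {S : Type*} [TopologicalSpace S] [ChartedSpace ES S] [IsManifold 𝓘(ℝ, ES) ∞ S]
    {V : Type*} [TopologicalSpace V] [ChartedSpace EV V] [IsManifold 𝓘(ℝ, EV) ∞ V]
    [MulAction H V] [ContMDiffSMul 𝓘(ℝ, EH) 𝓘(ℝ, EV) ∞ H V]
    -- the principal `G`-bundle `P → X`, the principal `H`-bundle `P → S = P / H`, and `S → X`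
    (act : P → G → P) (πPX : P → X) (πPS : P → S) (πSX : S → X)
    (_hPX : IsPrincipalBundle 𝓘(ℝ, EP) 𝓘(ℝ, EX) 𝓘(ℝ, EG) act πPX)
    (hPS : IsPrincipalBundle 𝓘(ℝ, EP) 𝓘(ℝ, ES) 𝓘(ℝ, EH) (fun p (g : H) => act p g) πPS)
    (_hcomp : ∀ p, πSX (πPS p) = πPX p)
    -- a principal connection on `P → S`
    (AS : Connection 𝓘(ℝ, EP) 𝓘(ℝ, ES) πPS)
    (_hAS : AS.IsPrincipal (fun p (g : H) => act p g)) :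
    -- it induces a unique associated connection `AY` on `Y = (P × V) / H → S`
    (∃! AY : Connection (𝓘(ℝ, ES).prod 𝓘(ℝ, EV)) 𝓘(ℝ, ES) (AssocBundle.proj 𝓘(ℝ, EV) V hPS),
      AS.IsAssociated (AssocBundle.mk 𝓘(ℝ, EV) V hPS) AY) ∧
    ∀ AY : Connection (𝓘(ℝ, ES).prod 𝓘(ℝ, EV)) 𝓘(ℝ, ES) (AssocBundle.proj 𝓘(ℝ, EV) V hPS),
      AS.IsAssociated (AssocBundle.mk 𝓘(ℝ, EV) V hPS) AY →
    -- let `h` be a global section of `S → X`, `P^h = h^* P` and `Y^h = h^* Y`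
    ∀ h : C^∞⟮𝓘(ℝ, EX), X; 𝓘(ℝ, ES), S⟯, (∀ x, πSX (h x) = x) →
    -- `P^h` is a principal `H`-bundle and `Y^h = (P^h × V) / H` is associated to it
    IsPrincipalBundle (𝓘(ℝ, EX).prod 𝓘(ℝ, EH)) 𝓘(ℝ, EX) 𝓘(ℝ, EH)
      (PrincipalPullback.rightAct hPS h) (BundlePullback.proj : PrincipalPullback hPS h → X) ∧
    IsAssociatedBundle (𝓘(ℝ, EX).prod 𝓘(ℝ, EH)) 𝓘(ℝ, EV)
      (PrincipalPullback.rightAct hPS h) (𝓘(ℝ, EX).prod 𝓘(ℝ, EV))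
      (AssocPullback.mk 𝓘(ℝ, EV) V hPS h) ∧
    -- the pull-back connections on `P^h` and `Y^h` exist and are unique
    (∃! APh : Connection (𝓘(ℝ, EX).prod 𝓘(ℝ, EH)) 𝓘(ℝ, EX)
        (BundlePullback.proj : PrincipalPullback hPS h → X),
      APh.IsPullback BundlePullback.toTotal h AS) ∧
    (∃! AYh : Connection (𝓘(ℝ, EX).prod 𝓘(ℝ, EV)) 𝓘(ℝ, EX)
        (BundlePullback.proj : AssocPullback 𝓘(ℝ, EV) V hPS h → X),
      AYh.IsPullback BundlePullback.toTotal h AY) ∧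
    ∀ (APh : Connection (𝓘(ℝ, EX).prod 𝓘(ℝ, EH)) 𝓘(ℝ, EX)
        (BundlePullback.proj : PrincipalPullback hPS h → X))
      (AYh : Connection (𝓘(ℝ, EX).prod 𝓘(ℝ, EV)) 𝓘(ℝ, EX)
        (BundlePullback.proj : AssocPullback 𝓘(ℝ, EV) V hPS h → X)),
      APh.IsPullback BundlePullback.toTotal h AS → AYh.IsPullback BundlePullback.toTotal h AY →
    -- the pull-back connection on `P^h` is principal and the one on `Y^h` is associated to it
    APh.IsPrincipal (PrincipalPullback.rightAct hPS h) ∧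
    APh.IsAssociated (AssocPullback.mk 𝓘(ℝ, EV) V hPS h) AYh ∧
    -- local formulas, with respect to coordinates `φ = (x^l)` on `X`, `χ = (x^l, s^j)` on `S`,
    -- `ψ = (y^i)` on `V`, a local section `z` of `P → S` and a basis `e_a` of the Lie algebra of `H`
    ∀ (n d m r : ℕ) (φ : OpenPartialHomeomorph X (Fin n → ℝ))
      (χ : OpenPartialHomeomorph S ((Fin n → ℝ) × (Fin d → ℝ)))
      (ψ : OpenPartialHomeomorph V (Fin m → ℝ)) (U : Set S) (z : S → P)
      (e : Module.Basis (Fin r) ℝ (GroupLieAlgebra 𝓘(ℝ, EH) H)),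
      IsSmoothChart 𝓘(ℝ, EX) φ → IsSmoothChart 𝓘(ℝ, ES) χ → IsFibredChart πSX φ χ →
      IsSmoothChart 𝓘(ℝ, EV) ψ → IsLocalSection 𝓘(ℝ, ES) 𝓘(ℝ, EP) πPS U z →
      (∃ Ax As, HasComponents (fun p (g : H) => act p g) AS χ U z e Ax As) ∧
      ∀ Ax As, HasComponents (fun p (g : H) => act p g) AS χ U z e Ax As →
        -- `AY = dx^l ⊗ (∂_l + A^a_l I_a^i ∂_i) + ds^j ⊗ (∂_j + A^a_j I_a^i ∂_i)`
        (∀ y ∈ χ.target, χ.symm y ∈ U → ∀ w ∈ ψ.target,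
          (∀ l : Fin n,
            AY.lift (AssocBundle.mk 𝓘(ℝ, EV) V hPS (z (χ.symm y), ψ.symm w))
              (mfderiv 𝓘(ℝ, (Fin n → ℝ) × (Fin d → ℝ)) 𝓘(ℝ, ES) χ.symm y (Pi.single l 1, 0)) =
            mfderiv 𝓘(ℝ, ((Fin n → ℝ) × (Fin d → ℝ)) × (Fin m → ℝ)) (𝓘(ℝ, ES).prod 𝓘(ℝ, EV))
              (fun q : ((Fin n → ℝ) × (Fin d → ℝ)) × (Fin m → ℝ) =>
                AssocBundle.mk 𝓘(ℝ, EV) V hPS (z (χ.symm q.1), ψ.symm q.2)) (y, w)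
              ((Pi.single l 1, 0), fun i => ∑ a, Ax a l y *
                generatorComponent 𝓘(ℝ, EV) ψ e a i w)) ∧
          (∀ j : Fin d,
            AY.lift (AssocBundle.mk 𝓘(ℝ, EV) V hPS (z (χ.symm y), ψ.symm w))
              (mfderiv 𝓘(ℝ, (Fin n → ℝ) × (Fin d → ℝ)) 𝓘(ℝ, ES) χ.symm y (0, Pi.single j 1)) =
            mfderiv 𝓘(ℝ, ((Fin n → ℝ) × (Fin d → ℝ)) × (Fin m → ℝ)) (𝓘(ℝ, ES).prod 𝓘(ℝ, EV))
              (fun q : ((Fin n → ℝ) × (Fin d → ℝ)) × (Fin m → ℝ) =>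
                AssocBundle.mk 𝓘(ℝ, EV) V hPS (z (χ.symm q.1), ψ.symm q.2)) (y, w)
              ((0, Pi.single j 1), fun i => ∑ a, As a j y *
                generatorComponent 𝓘(ℝ, EV) ψ e a i w))) ∧
        -- `h^* AY = dx^l ⊗ (∂_l + (A^a_j(x, h(x)) ∂_l h^j + A^a_l(x, h(x))) I_a^i ∂_i)`
        (∀ x ∈ φ.target, h (φ.symm x) ∈ χ.source ∩ U → ∀ w ∈ ψ.target, ∀ l : Fin n,
          AYh.lift (AssocPullback.mk 𝓘(ℝ, EV) V hPS h
              (PrincipalPullback.sectionPullback hPS h z (φ.symm x), ψ.symm w))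
            (mfderiv 𝓘(ℝ, Fin n → ℝ) 𝓘(ℝ, EX) φ.symm x (Pi.single l 1)) =
          mfderiv 𝓘(ℝ, (Fin n → ℝ) × (Fin m → ℝ)) (𝓘(ℝ, EX).prod 𝓘(ℝ, EV))
            (fun q : (Fin n → ℝ) × (Fin m → ℝ) => AssocPullback.mk 𝓘(ℝ, EV) V hPS h
              (PrincipalPullback.sectionPullback hPS h z (φ.symm q.1), ψ.symm q.2)) (x, w)
            (Pi.single l 1, fun i => ∑ a,
              ((∑ j, As a j (x, (χ (h (φ.symm x))).2) *
                  fderiv ℝ (fun x' => (χ (h (φ.symm x'))).2 j) x (Pi.single l 1)) +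
                Ax a l (x, (χ (h (φ.symm x))).2)) *
              generatorComponent 𝓘(ℝ, EV) ψ e a i w)) := by
  refine ⟨AssocBundle.existsUnique_isAssociated 𝓘(ℝ, EV) hPS _hAS, fun AY hAY h hh => ?_⟩
  refine ⟨PrincipalPullback.isPrincipalBundle hPS h,
    AssocPullback.isAssociatedBundle 𝓘(ℝ, EV) V hPS h,
    BundlePullback.existsUnique_isPullback hPS.isSmoothFiberBundle h AS,
    BundlePullback.existsUnique_isPullback (AssocBundle.isSmoothFiberBundle 𝓘(ℝ, EV) hPS) h AY,
    fun APh AYh hAPh hAYh => ?_⟩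
  refine ⟨PrincipalPullback.isPrincipal_of_isPullback hPS h _hAS hAPh,
    AssocPullback.isAssociated_of_isPullback 𝓘(ℝ, EV) V hPS h hAY hAPh hAYh, ?_⟩
  intro n d m r φ χ ψ U z e hφ hχ hφχ hψ hz
  refine ⟨exists_hasComponents hPS AS hχ hz e, fun Ax As hA => ⟨fun y hy hU w hw => ?_,
    fun x hx hhx w hw l => AssocPullback.lift_eq_of_hasComponents hAY hAYh hh hφ hχ hφχ hψ hz hA
      hx hhx hw l⟩⟩
  -- The formula for `AY` needs no section `h`: it is `Connection.IsAssociated.lift_eq` for `ζ = z ∘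
  -- χ.symm`, fed with the decomposition that defines the components.
  have hχs := hχ.contMDiffAt_symm hy
  have hζ := ContMDiffAt.comp (g := z) y (hz.2.1.contMDiffAt (hz.1.mem_nhds hU)) hχs
  obtain ⟨h1, h2⟩ := hA y hy hU
  exact ⟨fun l => hAY.lift_eq (ζ := fun y => z (χ.symm y)) hζ (hψ.contMDiffAt_symm hw) (h1 l)
      (mfderiv_symm_sum_mul_generatorComponent hψ e _ hw),
    fun j => hAY.lift_eq (ζ := fun y => z (χ.symm y)) hζ (hψ.contMDiffAt_symm hw) (h2 j)
      (mfderiv_symm_sum_mul_generatorComponent hψ e _ hw)⟩
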